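/- **Model.** A *network* on $n$ nodes is an undirected simple graph with $n$ nodes, in which the edges at each node $v$ are numbered by ports $0,\dots,\deg(v)-1$ (in an arbitrary way), and in which the nodes carry pairwise distinct IDs from $\{1,\dots,N\}$. A *randomized algorithm* runs in synchronous rounds. Initially all nodes are awake and each node knows only the network size $n$, its own ID, its own degree, and its own private infinite sequence of independent unbiased coin flips. In every round each node may send one message of arbitrary size through each of its ports, receives the messages sent to it in this round (knowing through which ports they arrive), and updates its local state by an arbitrary (measurable) local computation. Each node has a variable $\mathtt{status}\in\{\bot,\text{NON-ELECTED},\text{ELECTED}\}$, initially $\bot$. An execution *solves implicit leader election* if there is a round $T$ such that from round $T$ on exactly one node has status ELECTED and all other nodes have status NON-ELECTED. **Theorem.** For every constant $\varepsilon>0$ there are constants $c>0$ and $n_0$, depending only on $\varepsilon$, such that the following holds for all $n\ge n_0$ and all $N\ge n^4$. Let $A$ be a randomized algorithm (it may depend on $n$ and $N$) that solves implicit leader election with probability at least $\frac12+\varepsilon$ on every $n$-node network of diameter at most $2$ with distinct IDs from $\{1,\dots,N\}$. Then there is an $n$-node network of diameter at most $2$ with distinct IDs from $\{1,\dots,N\}$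 on which the expected total number of messages that $A$ sends, over all rounds, is at least $c\,n$. There is no restriction on the number of rounds. -/

import Mathlib

open MeasureTheory
open scoped ENNReal

namespace LeaderElection

/-- Messages are bit strings of arbitrary length. -/
abbrev Msg : Type := List Bool

/-- The values of the variable `status` of a node (`undecided` is `⊥`). -/
inductive Status : Type
  | undecided
  | nonElected
  | elected

/-- A network on `n` nodes: an undirected simple graph, a port numbering at every node (the ports of
`v` are `0, …, deg v - 1`, in bijection with the neighbours of `v`), and pairwise distinct IDs
in `{1, …, N}`. The type `Fin n` of nodes is only used for bookkeeping and is not accessible to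
algorithms. -/
structure Network (n N : ℕ) where
  graph : SimpleGraph (Fin n)
  deg : Fin n → ℕ
  port : (v : Fin n) → Fin (deg v) ≃ graph.neighborSet v
  id : Fin n → ℕ
  id_injective : Function.Injective id
  id_mem : ∀ v, id v ∈ Set.Icc 1 N

namespace Network

variable {n N : ℕ}

/-- The neighbour of `v` behind port `i`. -/
def nbr (net : Network n N) (v : Fin n) (i : Fin (net.deg v)) : Fin n :=
  (net.port v i).1

/-- The port number, at the neighbour of `v` behind port `i`, of the edge between the two. -/
def backPort (net : Network n N) (v : Fin n) (i : Fin (net.deg v)) :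
    Fin (net.deg (net.nbr v i)) :=
  (net.port (net.nbr v i)).symm ⟨v, (net.port v i).2.symm⟩

end Network

/-- A randomized synchronous distributed algorithm, in the port numbering model without initial
knowledge of the neighbours. A node starts with the network size `n`, its own ID, its own degree and
an infinite tape of private coin flips, from which its initial local state is computed. In every
round a node of degree `d` in state `s` sends `send d s i` through port `i` (`none` means that no
message is sent), and then updates its state using the messages it receives in this round, which it
sees according to the ports they arrive through. Local computation is not restricted, apart from
measurability. -/
structure Algorithm where
  State : Type
  [measurableSpace : MeasurableSpace State]
  init : (n id d : ℕ) → (ℕ → Bool) → State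
  send : (d : ℕ) → State → Fin d → Option Msg
  recv : (d : ℕ) → State → (Fin d → Option Msg) → State
  status : State → Status
  status_init : ∀ n id d coins, status (init n id d coins) = Status.undecided
  measurable_init : ∀ n id d, Measurable (init n id d)
  measurable_send : ∀ d i m, MeasurableSet {s | send d s i = m}
  measurable_recv : ∀ d inbox, Measurable fun s => recv d s inbox
  measurable_status : ∀ x, MeasurableSet {s | status s = x}

/-- The law of one infinite sequence of independent unbiased coin flips. -/
noncomputable def tapeMeasure : Measure (ℕ → Bool) :=
  Measure.infinitePi fun _ : ℕ => (PMF.uniformOfFintype Bool).toMeasure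

/-- The law of the private coin flips of `n` nodes: independent tapes, one for each node. -/
noncomputable def coinMeasure (n : ℕ) : Measure (Fin n → ℕ → Bool) :=
  Measure.pi fun _ : Fin n => tapeMeasure

namespace Algorithm

variable {n N : ℕ}

/-- The local states of all nodes after `t` rounds, for the coin flips `ω`. The message that `v`
receives through port `i` is the one sent in the same round by the neighbour behind port `i` through
the other end of that edge. -/
def run (A : Algorithm) (net : Network n N) (ω : Fin n → ℕ → Bool) : ℕ → Fin n → A.State
  | 0 => fun v => A.init n (net.id v) (net.deg v) (ω v)
  | t + 1 => fun v => A.recv (net.deg v) (A.run net ω t v) fun i =>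
      A.send (net.deg (net.nbr v i)) (A.run net ω t (net.nbr v i)) (net.backPort v i)

/-- After `t` rounds exactly one node is elected and all other nodes are non-elected. -/
def OneLeader (A : Algorithm) (net : Network n N) (ω : Fin n → ℕ → Bool) (t : ℕ) : Prop :=
  ∃ v, A.status (A.run net ω t v) = Status.elected ∧
    ∀ u, u ≠ v → A.status (A.run net ω t u) = Status.nonElected

/-- The execution solves implicit leader election in some number `T` of rounds: from round `T` on,
exactly one node is elected and all other nodes are non-elected. -/
def Solves (A : Algorithm) (net : Network n N) (ω : Fin n → ℕ → Bool) : Prop :=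
  ∃ T, ∀ t, T ≤ t → A.OneLeader net ω t

/-- The number of messages that are sent in round `t + 1`. -/
def messagesInRound (A : Algorithm) (net : Network n N) (ω : Fin n → ℕ → Bool) (t : ℕ) : ℕ :=
  ∑ v : Fin n, ∑ i : Fin (net.deg v),
    if (A.send (net.deg v) (A.run net ω t v) i).isSome then 1 else 0

/-- The total number of messages sent during the whole (infinite) execution. -/
noncomputable def messages (A : Algorithm) (net : Network n N) (ω : Fin n → ℕ → Bool) : ℝ≥0∞ :=
  ∑' t : ℕ, (A.messagesInRound net ω t : ℝ≥0∞)

/-- The probability that the algorithm solves implicit leader election. -/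
noncomputable def successProb (A : Algorithm) (net : Network n N) : ℝ :=
  (coinMeasure n).real {ω | A.Solves net ω}

/-- The expected total number of messages. -/
noncomputable def expectedMessages (A : Algorithm) (net : Network n N) : ℝ≥0∞ :=
  ∫⁻ ω, A.messages net ω ∂coinMeasure n

end Algorithm

end LeaderElection

/-! Suppose that `A` sends fewer than `ε² n / 4096` messages in expectation on every network of
diameter at most 2. Write `n = 2 * m + k + 1` with `k ≤ 1`, and glue two cliques on `m + 1` nodes
along a hub that takes the place of `x s` in clique `s`; a pendant at the hub corrects the parity.
If messages are rare, then for most `x` the replaced nodes neither send nor receive anything. If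
moreover the hub and the pendant do not speak spontaneously, the hub network runs exactly like
independent components: two cliques, a hub and a pendant (`run_hubNet`).

Exactly one leader then means that exactly one component elects. With sign `-1` for an electing
component, the signs multiply to `-1` (`totalSign_eq`). By independence the mean of this product,
summed over `x`, factors (`sum_integral_totalSign`). Among three cliques with disjoint IDs, two have
mean signs with a nonnegative product (`exists_mul_nonneg`). The IDs of the hub and the pendant come
from a complete network and a star on `n` nodes, where some node of the same degree would in
isolation rarely speak and elect itself with probability at most `1/2` (`exists_quiet_node`). So on
average over `x` the product is `-1` with probability at most `1/2`, which bounds the advantage of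
`A` by small error terms (`advantage_le`).

The separate cliques are not `n`-node networks, so the assumption on `A` does not bound their
messages directly. But when their message count first reaches a threshold, most places `x` had no
traffic before, so the hub networks have on average sent a constant fraction of these messages
(`le_sum_messagesBefore`). -/

namespace LeaderElection

/-! ### Coin measures and reversal of edges -/

instance : IsProbabilityMeasure tapeMeasure := by
  unfold tapeMeasure; infer_instance

instance (n : ℕ) : IsProbabilityMeasure (coinMeasure n) := by
  unfold coinMeasure; infer_instance

namespace Network

variable {n N : ℕ} (net : Network n N)

lemma nbr_injective (v : Fin n) : Function.Injective (net.nbr v) :=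
  Subtype.val_injective.comp (net.port v).injective

@[simp]
lemma nbr_backPort (v : Fin n) (i : Fin (net.deg v)) :
    net.nbr (net.nbr v i) (net.backPort v i) = v :=
  congrArg Subtype.val (Equiv.apply_symm_apply (net.port (net.nbr v i)) _)

/-- Traversing an edge permutes the pairs of a node and one of its ports. -/
lemma flip_injective : Function.Injective
    (fun d : Σ v, Fin (net.deg v) =>
      (⟨net.nbr d.1 d.2, net.backPort d.1 d.2⟩ : Σ v, Fin (net.deg v))) := by
  rintro ⟨v, i⟩ ⟨w, j⟩ h
  have h1 := congrArg (fun d : Σ v, Fin (net.deg v) => net.nbr d.1 d.2) h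
  simp only [nbr_backPort] at h1
  subst h1
  have h2 : i = j := net.nbr_injective v (congrArg Sigma.fst h)
  rw [h2]

lemma sum_flip (f : (v : Fin n) → Fin (net.deg v) → ℕ) :
    ∑ v, ∑ i, f (net.nbr v i) (net.backPort v i) = ∑ v, ∑ i, f v i := by
  rw [← Fintype.sum_sigma', ← Fintype.sum_sigma']
  exact (Finite.injective_iff_bijective.mp net.flip_injective).sum_comp fun d => f d.1 d.2

end Network

/-! ### Traffic, and nodes that run in isolation -/

namespace Algorithm

variable {n N : ℕ} (A : Algorithm)

instance : MeasurableSpace A.State := A.measurableSpace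

lemma send_congr {d d' : ℕ} {s s' : A.State} {i : Fin d} {i' : Fin d'} (hd : d = d') (hs : s = s')
    (hi : (i : ℕ) = i') : A.send d s i = A.send d' s' i' := by
  subst hd hs
  rw [Fin.ext hi]

/-- The algorithm that pretends that the network has size `n`. -/
def withSize (n : ℕ) : Algorithm where
  State := A.State
  init _ := A.init n
  send := A.send
  recv := A.recv
  status := A.status
  status_init _ := A.status_init n
  measurable_init _ := A.measurable_init n
  measurable_send := A.measurable_send
  measurable_recv := A.measurable_recv
  measurable_status := A.measurable_status

/-- The number of messages that a node of degree `d` in state `s` sends. -/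
def sends (d : ℕ) (s : A.State) : ℕ := ∑ i : Fin d, if (A.send d s i).isSome then 1 else 0

/-- The messages that `v` receives in round `t + 1`. -/
def inbox (net : Network n N) (ω : Fin n → ℕ → Bool) (t : ℕ) (v : Fin n) :
    Fin (net.deg v) → Option Msg := fun i =>
  A.send (net.deg (net.nbr v i)) (A.run net ω t (net.nbr v i)) (net.backPort v i)

lemma run_succ (net : Network n N) (ω : Fin n → ℕ → Bool) (t : ℕ) (v : Fin n) :
    A.run net ω (t + 1) v = A.recv (net.deg v) (A.run net ω t v) (A.inbox net ω t v) := rfl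

/-- The sender's view of `inbox`: it shows that nothing is sent towards a node that receives
nothing. -/
lemma send_nbr (net : Network n N) (ω : Fin n → ℕ → Bool) (t : ℕ) {u v : Fin n}
    (i : Fin (net.deg u)) (h : net.nbr u i = v) :
    ∃ j, A.inbox net ω t v j = A.send (net.deg u) (A.run net ω t u) i := by
  subst h
  refine ⟨net.backPort u i, A.send_congr (by simp) (by simp) ?_⟩
  have key : ∀ (w : Fin n) (hw : w = u) (j : Fin (net.deg w)),
      net.nbr w j = net.nbr u i → (j : ℕ) = i := by
    rintro w rfl j hj
    rw [net.nbr_injective _ hj]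
  exact key _ (by simp) _ (by rw [net.nbr_backPort])

/-- The number of messages sent in the first `T` rounds. -/
def messagesBefore (net : Network n N) (ω : Fin n → ℕ → Bool) (T : ℕ) : ℕ :=
  ∑ t ∈ Finset.range T, A.messagesInRound net ω t

/-- The number of messages that `v` sends or receives in the first `T` rounds. -/
def traffic (net : Network n N) (ω : Fin n → ℕ → Bool) (T : ℕ) (v : Fin n) : ℕ :=
  ∑ t ∈ Finset.range T, (A.sends (net.deg v) (A.run net ω t v) +
    ∑ i, if (A.inbox net ω t v i).isSome then 1 else 0)

/-- Every message is counted once at its sender and once at its receiver; `sum_flip` identifies the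
two counts. -/
lemma sum_traffic (net : Network n N) (ω : Fin n → ℕ → Bool) (T : ℕ) :
    ∑ v, A.traffic net ω T v = 2 * A.messagesBefore net ω T := by
  unfold traffic messagesBefore
  rw [Finset.sum_comm, Finset.mul_sum]
  refine Finset.sum_congr rfl fun t _ => ?_
  rw [Finset.sum_add_distrib, two_mul]
  congr 1
  exact net.sum_flip fun v i => if (A.send (net.deg v) (A.run net ω t v) i).isSome then 1 else 0

lemma sends_eq_zero {d : ℕ} {s : A.State} : A.sends d s = 0 ↔ ∀ i, A.send d s i = none := by
  simp [sends]

lemma traffic_eq_zero {net : Network n N} {ω : Fin n → ℕ → Bool} {T : ℕ} {v : Fin n} :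
    A.traffic net ω T v = 0 ↔ ∀ t < T, (∀ i, A.send (net.deg v) (A.run net ω t v) i = none) ∧
      ∀ i, A.inbox net ω t v i = none := by
  simp [traffic, sends_eq_zero]

/-- The local states of a node that never receives a message. -/
def silentRun (n id d : ℕ) (c : ℕ → Bool) : ℕ → A.State
  | 0 => A.init n id d c
  | t + 1 => A.recv d (silentRun n id d c t) fun _ => none

/-- A node that receives no messages sends none in the first `T` rounds. -/
def Quiet (n id d T : ℕ) (c : ℕ → Bool) : Prop :=
  ∀ t < T, ∀ i, A.send d (A.silentRun n id d c t) i = none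

lemma run_eq_silentRun {net : Network n N} {ω : Fin n → ℕ → Bool} {T : ℕ} {v : Fin n}
    (h : A.traffic net ω T v = 0) {t : ℕ} (ht : t ≤ T) :
    A.run net ω t v = A.silentRun n (net.id v) (net.deg v) (ω v) t := by
  induction t with
  | zero => rfl
  | succ t ih =>
    rw [run_succ, ih (by omega), silentRun]
    congr 1
    funext i
    exact (A.traffic_eq_zero.mp h t ht).2 i

lemma quiet_of_traffic {net : Network n N} {ω : Fin n → ℕ → Bool} {T : ℕ} {v : Fin n}
    (h : A.traffic net ω T v = 0) : A.Quiet n (net.id v) (net.deg v) T (ω v) := by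
  intro t ht i
  rw [← A.run_eq_silentRun h ht.le]
  exact (A.traffic_eq_zero.mp h t ht).1 i

/-! ### Measurability -/

/-- Measurability of `recv` is given only for a fixed inbox. Messages are bit strings, so there are
countably many inboxes to split over. -/
lemma measurable_recv_comp {Ω : Type*} [MeasurableSpace Ω] {d : ℕ} {s : Ω → A.State}
    {b : Ω → Fin d → Option Msg} (hs : Measurable s)
    (hb : ∀ i m, MeasurableSet {ω | b ω i = m}) : Measurable fun ω => A.recv d (s ω) (b ω) := by
  intro S hS
  have : (fun ω => A.recv d (s ω) (b ω)) ⁻¹' S =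
      ⋃ c : Fin d → Option Msg, (⋂ i, {ω | b ω i = c i}) ∩ s ⁻¹' ((fun x => A.recv d x c) ⁻¹' S) := by
    ext ω
    simp only [Set.mem_preimage, Set.mem_iUnion, Set.mem_inter_iff, Set.mem_iInter,
      Set.mem_ofPred_eq]
    constructor
    · intro h
      exact ⟨b ω, fun _ => rfl, h⟩
    · rintro ⟨c, hc, h⟩
      rwa [show b ω = c from funext hc]
  rw [this]
  exact MeasurableSet.iUnion fun c => (MeasurableSet.iInter fun i => hb i _).inter
    (hs (A.measurable_recv d c hS))

lemma measurable_run (net : Network n N) (t : ℕ) (v : Fin n) :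
    Measurable fun ω => A.run net ω t v := by
  induction t generalizing v with
  | zero => exact (A.measurable_init _ _ _).comp (measurable_pi_apply v)
  | succ t ih =>
    exact A.measurable_recv_comp (ih v) fun i m => (ih _) (A.measurable_send _ _ m)

lemma measurable_silentRun (n id d t : ℕ) : Measurable fun c => A.silentRun n id d c t := by
  induction t with
  | zero => exact A.measurable_init _ _ _
  | succ t ih => exact (A.measurable_recv d _).comp ih

lemma measurable_sends (d : ℕ) : Measurable (A.sends d) := by
  refine Finset.measurable_sum _ fun i _ => Measurable.ite ?_ measurable_const measurable_const
  have : {s | (A.send d s i).isSome = true} = {s | A.send d s i = none}ᶜ := by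
    ext s; simp [Option.isSome_iff_ne_none]
  rw [this]
  exact (A.measurable_send d i none).compl

lemma measurable_messagesBefore (net : Network n N) (T : ℕ) :
    Measurable fun ω => A.messagesBefore net ω T :=
  Finset.measurable_sum _ fun t _ => Finset.measurable_sum _ fun v _ =>
    (A.measurable_sends _).comp (A.measurable_run net t v)

lemma measurableSet_quiet (n id d T : ℕ) : MeasurableSet {c | A.Quiet n id d T c} := by
  simp only [Quiet, Set.ofPred_forall]
  exact MeasurableSet.iInter fun t => MeasurableSet.iInter fun _ => MeasurableSet.iInter fun i =>
    (A.measurable_silentRun n id d t) (A.measurable_send d i none)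

lemma measurableSet_silent_status (n id d T : ℕ) (x : Status) :
    MeasurableSet {c | A.status (A.silentRun n id d c T) = x} :=
  (A.measurable_silentRun n id d T) (A.measurable_status x)

/-- Exactly one node of `S` is elected after `t` rounds, and the other ones are non-elected. -/
def OneLeaderOn (net : Network n N) (S : Set (Fin n)) (ω : Fin n → ℕ → Bool) (t : ℕ) : Prop :=
  ∃ v ∈ S, A.status (A.run net ω t v) = Status.elected ∧
    ∀ u ∈ S, u ≠ v → A.status (A.run net ω t u) = Status.nonElected

lemma measurableSet_oneLeaderOn (net : Network n N) (S : Set (Fin n)) (t : ℕ) :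
    MeasurableSet {ω | A.OneLeaderOn net S ω t} := by
  have h : ∀ v x, MeasurableSet {ω | A.status (A.run net ω t v) = x} := fun v x =>
    (A.measurable_run net t v) (A.measurable_status x)
  simp only [OneLeaderOn, Set.ofPred_exists, Set.ofPred_and, Set.ofPred_forall]
  refine MeasurableSet.iUnion fun v => (MeasurableSet.const _).inter ((h _ _).inter ?_)
  exact MeasurableSet.iInter fun u => MeasurableSet.iInter fun _ => MeasurableSet.iInter fun _ =>
    h _ _

lemma oneLeaderOn_univ (net : Network n N) (ω : Fin n → ℕ → Bool) (t : ℕ) :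
    A.OneLeaderOn net Set.univ ω t ↔ A.OneLeader net ω t := by
  simp [OneLeaderOn, OneLeader]

lemma measurableSet_oneLeader (net : Network n N) (t : ℕ) :
    MeasurableSet {ω | A.OneLeader net ω t} := by
  simpa only [oneLeaderOn_univ] using A.measurableSet_oneLeaderOn net Set.univ t

/-! ### Expectations -/

lemma lintegral_messagesBefore_le (net : Network n N) (T : ℕ) :
    ∫⁻ ω, (A.messagesBefore net ω T : ℝ≥0∞) ∂coinMeasure n ≤ A.expectedMessages net := by
  refine lintegral_mono fun ω => ?_
  simp only [messagesBefore, Nat.cast_sum]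
  exact ENNReal.sum_le_tsum _

lemma integrable_messagesBefore {net : Network n N} (h : A.expectedMessages net ≠ ∞) (T : ℕ) :
    Integrable (fun ω => (A.messagesBefore net ω T : ℝ)) (coinMeasure n) := by
  refine ⟨((measurable_from_top (f := fun k : ℕ => (k : ℝ))).comp
    (A.measurable_messagesBefore net T)).aestronglyMeasurable, ?_⟩
  rw [hasFiniteIntegral_iff_enorm]
  simpa using (A.lintegral_messagesBefore_le net T).trans_lt h.lt_top

lemma integral_messagesBefore_le {net : Network n N} {b : ℝ} (hb : 0 ≤ b)
    (h : A.expectedMessages net ≤ ENNReal.ofReal b) (T : ℕ) :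
    ∫ ω, (A.messagesBefore net ω T : ℝ) ∂coinMeasure n ≤ b := by
  rw [integral_eq_lintegral_of_nonneg_ae (Filter.Eventually.of_forall fun _ => by positivity)
    (A.integrable_messagesBefore (h.trans_lt ENNReal.ofReal_lt_top).ne T).aestronglyMeasurable]
  refine ENNReal.toReal_le_of_le_ofReal hb ?_
  simpa using (A.lintegral_messagesBefore_le net T).trans h

/-- Continuity from below along the increasing events of having one leader from round `T` on. This
reduces unbounded executions to a finite horizon `T`. -/
lemma eventually_oneLeader {net : Network n N} {a b : ℝ} (hab : a < b)
    (h : b ≤ A.successProb net) :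
    ∀ᶠ T in Filter.atTop, a ≤ (coinMeasure n).real {ω | A.OneLeader net ω T} := by
  have hU : {ω | A.Solves net ω} = ⋃ T, {ω | ∀ t, T ≤ t → A.OneLeader net ω t} := by
    ext ω; simp [Solves]
  have hm : Monotone fun T => {ω | ∀ t, T ≤ t → A.OneLeader net ω t} :=
    fun T T' hT ω hω t ht => hω t (hT.trans ht)
  have ht := tendsto_measure_iUnion_atTop (μ := coinMeasure n) hm
  rw [← hU] at ht
  have ht' := (ENNReal.tendsto_toReal (measure_ne_top _ _)).comp ht
  filter_upwards [ht'.eventually_const_lt (hab.trans_le h)] with T hT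
  exact hT.le.trans (measureReal_mono fun ω hω => hω T le_rfl)

end Algorithm

/-! ### Construction of networks of diameter two -/

lemma ediam_le_two_of_hub {V : Type*} {G : SimpleGraph V} {c : V} (hc : ∀ v, v ≠ c → G.Adj c v) :
    G.ediam ≤ 2 := by
  have h1 : ∀ v, G.edist c v ≤ 1 := by
    intro v
    by_cases hv : v = c
    · simp [hv]
    · simpa using SimpleGraph.edist_le (hc v hv).toWalk
  refine SimpleGraph.ediam_le_of_edist_le fun u v => ?_
  calc G.edist u v ≤ G.edist u c + G.edist c v := SimpleGraph.edist_triangle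
    _ ≤ 1 + 1 := add_le_add (by rw [SimpleGraph.edist_comm]; exact h1 u) (h1 v)
    _ = 2 := one_add_one_eq_two

namespace Network

variable {n N : ℕ}

/-- The network in which `nbr v p` is the neighbour of `v` behind port `p`. -/
noncomputable def ofNbr {V : Type} (e : V ≃ Fin n) (deg : V → ℕ) (nbr : (v : V) → Fin (deg v) → V) (id : V → ℕ)
    (hinj : ∀ v, Function.Injective (nbr v)) (hne : ∀ v p, nbr v p ≠ v)
    (hsymm : ∀ v p, ∃ q, nbr (nbr v p) q = v) (hid : Function.Injective id)
    (hmem : ∀ v, id v ∈ Set.Icc 1 N) : Network n N where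
  graph :=
    { Adj := fun a b => ∃ p, e (nbr (e.symm a) p) = b
      symm := ⟨by
        rintro a b ⟨p, rfl⟩
        obtain ⟨q, hq⟩ := hsymm (e.symm a) p
        rw [e.symm_apply_apply]
        exact ⟨q, by rw [hq, e.apply_symm_apply]⟩⟩
      loopless := ⟨by
        rintro a ⟨p, hp⟩
        exact hne (e.symm a) p (e.injective (hp.trans (e.apply_symm_apply a).symm))⟩ }
  deg a := deg (e.symm a)
  port a := Equiv.ofInjective (fun p => e (nbr (e.symm a) p))
    (e.injective.comp (hinj (e.symm a)))
  id a := id (e.symm a)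
  id_injective := hid.comp e.symm.injective
  id_mem a := hmem _

end Network

/-- A run is determined by its recursion, here for networks that are given by `Network.ofNbr`. -/
lemma Algorithm.run_ofNbr_eq {n N : ℕ} (A : Algorithm) {V : Type} {e : V ≃ Fin n} {deg : V → ℕ}
    {nbr : (v : V) → Fin (deg v) → V} {id : V → ℕ}
    {hinj : ∀ v, Function.Injective (nbr v)} {hne : ∀ v p, nbr v p ≠ v}
    {hsymm : ∀ v p, ∃ q, nbr (nbr v p) q = v} {hid : Function.Injective id}
    {hmem : ∀ v, id v ∈ Set.Icc 1 N} {ω : Fin n → ℕ → Bool} {T : ℕ}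
    (ref : ℕ → V → A.State) (inb : ℕ → (v : V) → Fin (deg v) → Option Msg)
    (h0 : ∀ v, ref 0 v = A.init n (id v) (deg v) (ω (e v)))
    (hstep : ∀ t < T, ∀ v, ref (t + 1) v = A.recv (deg v) (ref t v) (inb t v))
    (hinb : ∀ t < T, ∀ v p q, nbr (nbr v p) q = v →
      inb t v p = A.send (deg (nbr v p)) (ref t (nbr v p)) q)
    {t : ℕ} (ht : t ≤ T) (v : V) :
    A.run (Network.ofNbr e deg nbr id hinj hne hsymm hid hmem) ω t (e v) = ref t v := by
  set net := Network.ofNbr e deg nbr id hinj hne hsymm hid hmem with hnet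
  suffices h : ∀ a, A.run net ω t a = ref t (e.symm a) by rw [h, e.symm_apply_apply]
  induction t with
  | zero => intro a; rw [h0, e.apply_symm_apply]; rfl
  | succ t ih =>
    intro a
    rw [hstep t ht, A.run_succ, ih (by omega) a]
    congr 1
    funext p
    have hnb : net.nbr a p = e (nbr (e.symm a) p) := rfl
    obtain ⟨q, hq⟩ := hsymm (e.symm a) p
    rw [hinb t ht _ p q hq]
    refine A.send_congr ?_ ?_ ?_
    · change deg (e.symm (net.nbr a p)) = _
      rw [hnb, e.symm_apply_apply]
    · rw [ih (by omega), hnb, e.symm_apply_apply]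
    -- The two ports have types that agree only propositionally, so their values are compared; both
    -- lead to the same node and `nbr` is injective.
    · have key : ∀ (w : V), w = nbr (e.symm a) p → ∀ j : Fin (deg w), nbr w j = e.symm a →
          (j : ℕ) = q := by
        rintro w rfl j hj
        rw [hinj _ (hj.trans hq.symm)]
      refine key (e.symm (net.nbr a p)) (by rw [hnb, e.symm_apply_apply]) (net.backPort a p) ?_
      exact e.injective ((net.nbr_backPort a p).trans (e.apply_symm_apply a).symm)

/-- The complete network on `m + 1` nodes. -/
noncomputable def clique {m N : ℕ} (id : Fin (m + 1) → ℕ) (hid : Function.Injective id)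
    (hmem : ∀ v, id v ∈ Set.Icc 1 N) : Network (m + 1) N :=
  Network.ofNbr (Equiv.refl _) (fun _ => m) (fun v => v.succAbove) id
    (fun _ => Fin.succAbove_right_injective) (fun v p => Fin.succAbove_ne v p)
    (fun v p => Fin.exists_succAbove_eq (Fin.succAbove_ne v p).symm) hid hmem

lemma ediam_clique {m N : ℕ} (id : Fin (m + 1) → ℕ) (hid : Function.Injective id)
    (hmem : ∀ v, id v ∈ Set.Icc 1 N) : (clique id hid hmem).graph.ediam ≤ 2 :=
  ediam_le_two_of_hub (c := 0) fun _ hv => Fin.exists_succAbove_eq hv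

/-! ### Hub networks and their simulation by separate components -/

/-- The nodes of a hub network: a hub (`none`), two groups of `m` nodes, and `k` pendants. -/
abbrev HubNode (m k : ℕ) : Type := Option ((Bool × Fin m) ⊕ Fin k)

namespace HubNode

variable {m k : ℕ}

/-- The nodes of `Fin (m + 1)` become the nodes of one group and, for the node `x`, the hub. -/
def ofClique (x : Fin (m + 1)) (s : Bool) (u : Fin (m + 1)) : HubNode m k :=
  (finSuccEquiv' x u).map fun a => Sum.inl (s, a)

@[simp]
lemma ofClique_self (x : Fin (m + 1)) (s : Bool) : (ofClique x s x : HubNode m k) = none := by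
  simp [ofClique]

@[simp]
lemma ofClique_succAbove (x : Fin (m + 1)) (s : Bool) (a : Fin m) :
    (ofClique x s (x.succAbove a) : HubNode m k) = some (Sum.inl (s, a)) := by
  simp [ofClique]

lemma ofClique_injective (x : Fin (m + 1)) (s : Bool) :
    Function.Injective (ofClique x s : _ → HubNode m k) :=
  (Option.map_injective fun a b h => by simpa using h).comp (finSuccEquiv' x).injective

def deg : HubNode m k → ℕ
  | none => 2 * m + k
  | some (Sum.inl _) => m
  | some (Sum.inr _) => 1

/-- The order of the ports of the hub. -/
noncomputable def hubPort (m k : ℕ) : Fin (2 * m + k) ≃ (Bool × Fin m) ⊕ Fin k :=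
  (Fintype.equivFinOfCardEq (by simp)).symm

/-- Every group together with the hub is a clique in which the hub takes the place of `x s`. -/
noncomputable def nbr (x : Bool → Fin (m + 1)) : (v : HubNode m k) → Fin v.deg → HubNode m k
  | none => fun p => some (hubPort m k p)
  | some (Sum.inl (s, a)) => fun p => ofClique (x s) s (((x s).succAbove a).succAbove p)
  | some (Sum.inr _) => fun _ => none

lemma nbr_injective (x : Bool → Fin (m + 1)) : (v : HubNode m k) → Function.Injective (nbr x v)
  | none => (Option.some_injective _).comp (hubPort m k).injective
  | some (Sum.inl (_, _)) => (ofClique_injective _ _).comp Fin.succAbove_right_injective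
  | some (Sum.inr _) => fun p q _ => Subsingleton.elim (α := Fin 1) p q

lemma nbr_ne (x : Bool → Fin (m + 1)) : (v : HubNode m k) → (p : Fin v.deg) → nbr x v p ≠ v
  | none => fun p => by simp [nbr]
  | some (Sum.inl (s, a)) => fun p h => by
    exact Fin.succAbove_ne _ _ (ofClique_injective (k := k) _ _
      (h.trans (ofClique_succAbove (x s) s a).symm))
  | some (Sum.inr _) => fun p => by simp [nbr]

lemma exists_nbr_eq_none (x : Bool → Fin (m + 1)) :
    (z : (Bool × Fin m) ⊕ Fin k) → ∃ q, nbr x (some z) q = none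
  | Sum.inl (s, a) => by
    obtain ⟨q, hq⟩ := Fin.exists_succAbove_eq (Fin.succAbove_ne (x s) a).symm
    exact ⟨q, by simp [nbr, hq]⟩
  | Sum.inr _ => ⟨(0 : Fin 1), rfl⟩

lemma exists_nbr_nbr (x : Bool → Fin (m + 1)) :
    (v : HubNode m k) → (p : Fin v.deg) → ∃ q, nbr x (nbr x v p) q = v
  | none => fun p => exists_nbr_eq_none x _
  | some (Sum.inl (s, a)) => fun p => by
    rcases Fin.eq_self_or_eq_succAbove (x s) (((x s).succAbove a).succAbove p) with h | ⟨b, h⟩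
    · have : nbr x (some (Sum.inl (s, a)) : HubNode m k) p = none := by
        change ofClique _ _ _ = _
        rw [h, ofClique_self]
      rw [this]
      exact ⟨(hubPort m k).symm (Sum.inl (s, a)), by simp [nbr]⟩
    · have : nbr x (some (Sum.inl (s, a)) : HubNode m k) p = some (Sum.inl (s, b)) := by
        change ofClique _ _ _ = _
        rw [h, ofClique_succAbove]
      rw [this]
      have hne : (x s).succAbove a ≠ (x s).succAbove b := h ▸ (Fin.succAbove_ne _ _).symm
      obtain ⟨q, hq⟩ := Fin.exists_succAbove_eq hne
      exact ⟨q, by simp [nbr, hq]⟩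
  | some (Sum.inr j) => fun _ => ⟨(hubPort m k).symm (Sum.inr j), by simp [nbr]⟩

end HubNode

/-- Two cliques on `m + 1` nodes that share a node, the hub, with `k` pendants attached to the hub.
The ports in the cliques are those of `clique`, where the hub takes the place of `x s`. -/
noncomputable def hubNet {m k n N : ℕ} (e : HubNode m k ≃ Fin n) (x : Bool → Fin (m + 1))
    (id : HubNode m k → ℕ) (hid : Function.Injective id) (hmem : ∀ v, id v ∈ Set.Icc 1 N) :
    Network n N :=
  Network.ofNbr e HubNode.deg (HubNode.nbr x) id (HubNode.nbr_injective x) (HubNode.nbr_ne x)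
    (HubNode.exists_nbr_nbr x) hid hmem

lemma ediam_hubNet {m k n N : ℕ} (e : HubNode m k ≃ Fin n) (x : Bool → Fin (m + 1))
    (id : HubNode m k → ℕ) (hid : Function.Injective id) (hmem : ∀ v, id v ∈ Set.Icc 1 N) :
    (hubNet e x id hid hmem).graph.ediam ≤ 2 := by
  refine ediam_le_two_of_hub (c := e none) fun v hv => ?_
  obtain ⟨w, rfl⟩ := e.surjective v
  obtain _ | z := w
  · exact absurd rfl hv
  refine SimpleGraph.Adj.symm ?_
  obtain ⟨q, hq⟩ := HubNode.exists_nbr_eq_none x z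
  change ∃ p, e (HubNode.nbr x (e.symm (e (some z))) p) = e none
  rw [e.symm_apply_apply]
  exact ⟨q, by rw [hq]⟩

/-- The coin flips of two cliques on `m + 1` nodes, a hub and `k` pendants. -/
abbrev RefCoins (m k : ℕ) : Type :=
  (Bool → Fin (m + 1) → ℕ → Bool) × (Option (Fin k) → ℕ → Bool)

/-- The coin flips of the nodes of a hub network. -/
def hubCoins {m k : ℕ} (x : Bool → Fin (m + 1)) (ω : RefCoins m k) : HubNode m k → ℕ → Bool
  | none => ω.2 none
  | some (Sum.inl (s, a)) => ω.1 s ((x s).succAbove a)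
  | some (Sum.inr j) => ω.2 (some j)

/-- The IDs of the nodes of a hub network. -/
def hubId {m k : ℕ} (x : Bool → Fin (m + 1)) (idc : Bool → Fin (m + 1) → ℕ)
    (ido : Option (Fin k) → ℕ) : HubNode m k → ℕ
  | none => ido none
  | some (Sum.inl (s, a)) => idc s ((x s).succAbove a)
  | some (Sum.inr j) => ido (some j)

/-- The degrees of the hub and of the pendants. -/
def outerDeg (m k : ℕ) : Option (Fin k) → ℕ
  | none => 2 * m + k
  | some _ => 1

/-- The states of the nodes of a hub network as long as neither the hub nor a pendant communicates:
the groups run in separate cliques, the hub and the pendants in isolation. -/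
def refRun (A : Algorithm) {m k N : ℕ} (n : ℕ) (K : Bool → Network (m + 1) N)
    (ido : Option (Fin k) → ℕ) (x : Bool → Fin (m + 1)) (ω : RefCoins m k) (t : ℕ) :
    HubNode m k → A.State
  | none => A.silentRun n (ido none) (2 * m + k) (ω.2 none) t
  | some (Sum.inl (s, a)) => (A.withSize n).run (K s) (ω.1 s) t ((x s).succAbove a)
  | some (Sum.inr j) => A.silentRun n (ido (some j)) 1 (ω.2 (some j)) t

/-- The separate runs satisfy the recursion of the hub network: the edges inside a group are those
of the clique with the same ports, and the edges at the hub carry no messages in either system. A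
group node thus cannot tell the hub from `x s`. -/
lemma run_hubNet (A : Algorithm) {m k n N : ℕ} (e : HubNode m k ≃ Fin n)
    (x : Bool → Fin (m + 1)) (idc : Bool → Fin (m + 1) → ℕ) (ido : Option (Fin k) → ℕ)
    (hidc : ∀ s, Function.Injective (idc s)) (hmemc : ∀ s v, idc s v ∈ Set.Icc 1 N)
    (hid : Function.Injective (hubId x idc ido)) (hmem : ∀ v, hubId x idc ido v ∈ Set.Icc 1 N)
    (ω : RefCoins m k) {T : ℕ}
    (hx : ∀ s, (A.withSize n).traffic (clique (idc s) (hidc s) (hmemc s)) (ω.1 s) T (x s) = 0)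
    (hq : ∀ o, A.Quiet n (ido o) (outerDeg m k o) T (ω.2 o)) {t : ℕ} (ht : t ≤ T)
    (v : HubNode m k) :
    A.run (hubNet e x (hubId x idc ido) hid hmem) (hubCoins x ω ∘ e.symm) t (e v) =
      refRun A n (fun s => clique (idc s) (hidc s) (hmemc s)) ido x ω t v := by
  set K := fun s => clique (idc s) (hidc s) (hmemc s) with hK
  have hx' := fun s => ((A.withSize n).traffic_eq_zero.mp (hx s))
  refine A.run_ofNbr_eq (T := T) (refRun A n K ido x ω)
    (fun t v => match v with
      | none => fun _ => none
      | some (Sum.inl (s, a)) => (A.withSize n).inbox (K s) (ω.1 s) t ((x s).succAbove a)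
      | some (Sum.inr j) => fun _ => none) ?_ ?_ ?_ ht v
  · rintro (_ | ⟨s, a⟩ | j) <;> simp [refRun, hubCoins, hubId] <;> rfl
  · rintro t - (_ | ⟨s, a⟩ | j) <;> rfl
  · rintro t htT (_ | ⟨s, a⟩ | j) p q hpq
    -- Messages to the hub: in the clique the same port leads to `x s`, which receives nothing, and
    -- the pendants are quiet.
    · suffices h : ∀ z q, HubNode.nbr x (some z) q = none →
          none = A.send (HubNode.deg (some z)) (refRun A n K ido x ω t (some z)) q from h _ q hpq
      clear p q hpq
      intro z q hpq
      rcases z with ⟨s, a⟩ | j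
      · have h1 : ((x s).succAbove a).succAbove q = x s :=
          HubNode.ofClique_injective (k := k) (x s) s (hpq.trans (HubNode.ofClique_self _ _).symm)
        obtain ⟨j, hj⟩ := (A.withSize n).send_nbr (K s) (ω.1 s) t (u := (x s).succAbove a) q h1
        exact ((hx' s t htT).2 j).symm.trans hj
      · exact (hq (some j) t htT q).symm
    · change (A.withSize n).inbox (K s) (ω.1 s) t ((x s).succAbove a) p = _
      have hnb : (K s).nbr ((x s).succAbove a) p = ((x s).succAbove a).succAbove p := rfl
      have hG : HubNode.nbr x (some (Sum.inl (s, a)) : HubNode m k) p =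
        HubNode.ofClique (x s) s (((x s).succAbove a).succAbove p) := rfl
      -- The neighbour in the clique is either `x s`, which is silent just like the hub, or a node
      -- of the same group, which uses the same port.
      rcases Fin.eq_self_or_eq_succAbove (x s) (((x s).succAbove a).succAbove p) with h | ⟨b, h⟩
      · rw [h, HubNode.ofClique_self] at hG
        revert q
        rw [hG]
        intro q hpq
        refine Eq.trans ?_ (hq none t htT q).symm
        have := fun w (hw : w = x s) (j : Fin ((K s).deg w)) =>
          show (A.withSize n).send _ ((A.withSize n).run (K s) (ω.1 s) t w) j = none by
            subst hw; exact (hx' s t htT).1 j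
        exact this _ (hnb.trans h) _
      · rw [h, HubNode.ofClique_succAbove] at hG
        revert q
        rw [hG]
        intro q hpq
        have h2 : ((x s).succAbove b).succAbove q = (x s).succAbove a :=
          HubNode.ofClique_injective (k := k) (x s) s
            (hpq.trans (HubNode.ofClique_succAbove _ _ _).symm)
        refine A.send_congr rfl (congrArg _ (hnb.trans h)) ?_
        have key : ∀ (w : Fin (m + 1)), w = (x s).succAbove b → ∀ j : Fin ((K s).deg w),
            (K s).nbr w j = (x s).succAbove a → (j : ℕ) = q := by
          rintro w rfl j hj
          exact congrArg Fin.val ((K s).nbr_injective _ (a₂ := q) (hj.trans h2.symm))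
        exact key _ (hnb.trans h) _ ((K s).nbr_backPort _ _)
    · exact (hq none t htT q).symm

/-! ### Indicators as real functions -/

open Classical in
/-- The indicator of a proposition, as a real number. -/
noncomputable def ind (p : Prop) : ℝ := if p then 1 else 0

section Ind

variable {p : Prop}

lemma ind_of_true (h : p) : ind p = 1 := if_pos h

lemma ind_of_false (h : ¬ p) : ind p = 0 := if_neg h

lemma ind_nonneg : 0 ≤ ind p := by unfold ind; split_ifs <;> norm_num

lemma ind_le_one : ind p ≤ 1 := by unfold ind; split_ifs <;> norm_num

variable {Ω : Type*} {q : Ω → Prop}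

lemma ind_eq_indicator : (fun ω => ind (q ω)) = {ω | q ω}.indicator fun _ => (1 : ℝ) := by
  funext ω
  by_cases h : q ω
  · rw [ind_of_true h, Set.indicator_of_mem (show ω ∈ {ω | q ω} from h)]
  · rw [ind_of_false h, Set.indicator_of_notMem (show ω ∉ {ω | q ω} from h)]

variable [MeasurableSpace Ω] {μ : Measure Ω}

lemma integrable_ind [IsFiniteMeasure μ] (hq : MeasurableSet {ω | q ω}) :
    Integrable (fun ω => ind (q ω)) μ := by
  rw [ind_eq_indicator]
  exact (integrable_const (1 : ℝ)).indicator hq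

lemma integral_ind (hq : MeasurableSet {ω | q ω}) :
    ∫ ω, ind (q ω) ∂μ = μ.real {ω | q ω} := by
  rw [ind_eq_indicator]
  exact integral_indicator_one hq

end Ind

/-! ### Nodes that are harmless in isolation -/

/-- In a network with few messages and a reliable election, some node is unlikely to elect itself
or to send a message before it receives one. -/
lemma Algorithm.exists_quiet_node (A : Algorithm) {n N : ℕ} {net : Network n N} {T d : ℕ}
    {S : Finset (Fin n)} (hS : ∀ v ∈ S, net.deg v = d) (hne : S.Nonempty) {b δ r : ℝ}
    (hb : 0 ≤ b) (hr : 0 ≤ r) (hmsg : A.expectedMessages net ≤ ENNReal.ofReal b)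
    (hlead : 1 / 2 + δ ≤ (coinMeasure n).real {ω | A.OneLeader net ω T})
    (hnum : 1 + 2 * b * (1 + r) ≤ δ * S.card) :
    ∃ v ∈ S, tapeMeasure.real {c | A.status (A.silentRun n (net.id v) d c T) = Status.elected} +
      r * tapeMeasure.real {c | ¬ A.Quiet n (net.id v) d T c} ≤ 1 / 2 := by
  set E : Fin n → (ℕ → Bool) → Prop := fun v c =>
    A.status (A.silentRun n (net.id v) d c T) = Status.elected with hE
  set Q : Fin n → (ℕ → Bool) → Prop := fun v c => ¬ A.Quiet n (net.id v) d T c with hQ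
  have hEm : ∀ v, MeasurableSet {c | E v c} := fun v => A.measurableSet_silent_status _ _ _ _ _
  have hQm : ∀ v, MeasurableSet {c | Q v c} := fun v => (A.measurableSet_quiet _ _ _ _).compl
  have hpt : ∀ ω, ∑ v ∈ S, (ind (E v (ω v)) + r * ind (Q v (ω v))) ≤
      2 * (1 + r) * A.messagesBefore net ω T + (1 + S.card * (1 - ind (A.OneLeader net ω T))) := by
    intro ω
    set el : Fin n → ℝ := fun v => ind (A.status (A.run net ω T v) = Status.elected) with hel
    -- A node without traffic runs as in isolation, so it is quiet and its two elections agree. Any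
    -- other node costs at most `1 + r`, and its traffic is at least 1.
    have h1 : ∀ v ∈ S, ind (E v (ω v)) + r * ind (Q v (ω v)) ≤
        (1 + r) * A.traffic net ω T v + el v := by
      intro v hv
      have hel0 : 0 ≤ el v := ind_nonneg
      have hE1 : ind (E v (ω v)) ≤ 1 := ind_le_one
      have hQ1 : ind (Q v (ω v)) ≤ 1 := ind_le_one
      by_cases htr : A.traffic net ω T v = 0
      · have hQ0 : ind (Q v (ω v)) = 0 := by
          refine ind_of_false (not_not.mpr ?_)
          have := A.quiet_of_traffic htr
          rwa [hS v hv] at this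
        have hEe : ind (E v (ω v)) = el v := by
          simp only [hel, hE, A.run_eq_silentRun htr le_rfl, hS v hv]
        rw [hQ0, hEe, htr]
        simp
      · have : (1 : ℝ) ≤ A.traffic net ω T v := by exact_mod_cast Nat.one_le_iff_ne_zero.mpr htr
        nlinarith
    have h2 : ∑ v ∈ S, el v ≤ 1 + S.card * (1 - ind (A.OneLeader net ω T)) := by
      by_cases hω : A.OneLeader net ω T
      · rw [ind_of_true hω]
        obtain ⟨w, hw, hw'⟩ := hω
        have : ∀ v ∈ S, el v ≤ if v = w then 1 else 0 := by
          intro v _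
          by_cases hvw : v = w
          · simpa [hvw] using ind_le_one
          · simp [hel, hw' v hvw, hvw, ind]
        refine (Finset.sum_le_sum this).trans ?_
        simp only [Finset.sum_ite_eq', sub_self, mul_zero, add_zero]
        split_ifs <;> norm_num
      · rw [ind_of_false hω]
        refine (Finset.sum_le_sum fun v _ => (ind_le_one : el v ≤ 1)).trans ?_
        simp
    have h3 : ∑ v ∈ S, (A.traffic net ω T v : ℝ) ≤ 2 * A.messagesBefore net ω T := by
      have h4 : ∑ v ∈ S, A.traffic net ω T v ≤ 2 * A.messagesBefore net ω T :=
        A.sum_traffic net ω T ▸ Finset.sum_le_univ_sum_of_nonneg fun _ => Nat.zero_le _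
      exact_mod_cast h4
    calc _ ≤ ∑ v ∈ S, ((1 + r) * A.traffic net ω T v + el v) := Finset.sum_le_sum h1
      _ = (1 + r) * ∑ v ∈ S, (A.traffic net ω T v : ℝ) + ∑ v ∈ S, el v := by
        rw [Finset.sum_add_distrib, Finset.mul_sum]
      _ ≤ (1 + r) * (2 * A.messagesBefore net ω T) + _ :=
        add_le_add (mul_le_mul_of_nonneg_left h3 (by linarith)) h2
      _ = _ := by ring
  have hEi : ∀ v, Integrable (fun ω : Fin n → ℕ → Bool => ind (E v (ω v))) (coinMeasure n) :=
    fun v => integrable_ind ((hEm v).preimage (measurable_pi_apply v))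
  have hQi : ∀ v, Integrable (fun ω : Fin n → ℕ → Bool => ind (Q v (ω v))) (coinMeasure n) :=
    fun v => integrable_ind ((hQm v).preimage (measurable_pi_apply v))
  have hev : ∀ v (s : (ℕ → Bool) → Prop), MeasurableSet {c | s c} →
      ∫ ω, ind (s (ω v)) ∂coinMeasure n = tapeMeasure.real {c | s c} := by
    intro v s hs
    rw [integral_ind (q := fun ω : Fin n → ℕ → Bool => s (ω v))
      (hs.preimage (measurable_pi_apply v))]
    exact (measurePreserving_eval (fun _ : Fin n => tapeMeasure) v).measureReal_preimage
      hs.nullMeasurableSet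
  have hLm := A.measurableSet_oneLeader net T
  have hmi := A.integrable_messagesBefore (hmsg.trans_lt ENNReal.ofReal_lt_top).ne T
  have hLi := integrable_ind (μ := coinMeasure n) hLm
  have hEQ : ∀ v ∈ S, Integrable (fun ω : Fin n → ℕ → Bool =>
      ind (E v (ω v)) + r * ind (Q v (ω v))) (coinMeasure n) :=
    fun v _ => (hEi v).add ((hQi v).const_mul r)
  have hL1 : Integrable (fun ω => 1 - ind (A.OneLeader net ω T)) (coinMeasure n) :=
    (integrable_const _).sub hLi
  have hL2 : Integrable (fun ω => 1 + S.card * (1 - ind (A.OneLeader net ω T))) (coinMeasure n) :=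
    (integrable_const _).add (hL1.const_mul _)
  have hbound := integral_mono (integrable_finsetSum S hEQ)
    ((hmi.const_mul (2 * (1 + r))).add hL2) hpt
  have hlhs : ∫ ω, ∑ v ∈ S, (ind (E v (ω v)) + r * ind (Q v (ω v))) ∂coinMeasure n =
      ∑ v ∈ S, (tapeMeasure.real {c | E v c} + r * tapeMeasure.real {c | Q v c}) := by
    rw [integral_finsetSum _ hEQ]
    refine Finset.sum_congr rfl fun v _ => ?_
    rw [integral_add (hEi v) ((hQi v).const_mul r), integral_const_mul, hev v _ (hEm v),
      hev v _ (hQm v)]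
  have hrhs : ∫ ω, (2 * (1 + r) * A.messagesBefore net ω T +
      (1 + S.card * (1 - ind (A.OneLeader net ω T)))) ∂coinMeasure n =
      2 * (1 + r) * ∫ ω, (A.messagesBefore net ω T : ℝ) ∂coinMeasure n +
      (1 + S.card * (1 - (coinMeasure n).real {ω | A.OneLeader net ω T})) := by
    rw [integral_add (hmi.const_mul _) hL2, integral_const_mul,
      integral_add (integrable_const _) (hL1.const_mul _),
      integral_const_mul, integral_sub (integrable_const _) hLi, integral_ind hLm]
    simp
  replace hbound := hlhs.symm.trans_le (hbound.trans_eq hrhs)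
  have hm := A.integral_messagesBefore_le hb hmsg T
  have hc : (0 : ℝ) < S.card := by exact_mod_cast hne.card_pos
  -- Some node is at most the average, and `hnum` makes the sum `1 + 2 * b * (1 + r) + S.card * (1 /
  -- 2 - δ)` at most `S.card / 2`.
  refine Finset.exists_le_of_sum_le hne (hbound.trans ?_)
  rw [Finset.sum_const, nsmul_eq_mul]
  nlinarith

/-! ### Coupling of all hub networks -/

/-- The law of the coin flips of two cliques, a hub and `k` pendants. -/
noncomputable def refMeasure (m k : ℕ) : Measure (RefCoins m k) :=
  (Measure.pi fun _ : Bool => coinMeasure (m + 1)).prod (Measure.pi fun _ => tapeMeasure)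

instance (m k : ℕ) : IsProbabilityMeasure (refMeasure m k) := by
  unfold refMeasure; infer_instance

lemma measurable_hubCoins {m k n : ℕ} (e : HubNode m k ≃ Fin n) (x : Bool → Fin (m + 1)) :
    Measurable fun ω : RefCoins m k => hubCoins x ω ∘ e.symm := by
  refine measurable_pi_lambda _ fun a => ?_
  simp only [Function.comp]
  rcases e.symm a with _ | ⟨s, a⟩ | j <;> simp only [hubCoins] <;> fun_prop

/-- One probability space serves all `x`: the hub has its own tape and the tapes of the replaced
nodes are discarded, so the factor `R` is `Set.univ` there. The clique runs therefore do not depend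
on `x`. -/
lemma measurePreserving_hubCoins {m k n : ℕ} (e : HubNode m k ≃ Fin n)
    (x : Bool → Fin (m + 1)) :
    MeasurePreserving (fun ω : RefCoins m k => hubCoins x ω ∘ e.symm) (refMeasure m k)
      (coinMeasure n) := by
  refine ⟨measurable_hubCoins e x, (Measure.pi_eq fun S hS => ?_).symm⟩
  rw [Measure.map_apply (measurable_hubCoins e x) (MeasurableSet.univ_pi hS)]
  set R : Bool → Fin (m + 1) → Set (ℕ → Bool) := fun s u =>
    (finSuccEquiv' (x s) u).elim Set.univ fun a => S (e (some (Sum.inl (s, a)))) with hR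
  set O : Option (Fin k) → Set (ℕ → Bool) := fun o =>
    S (e (o.map Sum.inr)) with hO
  have hpre : (fun ω : RefCoins m k => hubCoins x ω ∘ e.symm) ⁻¹' Set.univ.pi S =
      (Set.univ.pi fun s => Set.univ.pi (R s)) ×ˢ Set.univ.pi O := by
    ext ω
    simp only [Set.mem_preimage, Set.mem_univ_pi, Set.mem_prod, Function.comp]
    constructor
    · intro h
      have h' : ∀ v, hubCoins x ω v ∈ S (e v) := fun v => by simpa using h (e v)
      refine ⟨fun s u => ?_, ?_⟩
      · rcases Fin.eq_self_or_eq_succAbove (x s) u with rfl | ⟨a, rfl⟩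
        · simp [hR]
        · simpa [hR, hubCoins] using h' (some (Sum.inl (s, a)))
      · rintro (_ | j)
        · exact h' none
        · exact h' (some (Sum.inr j))
    · rintro ⟨h1, h2⟩ a
      obtain ⟨v, rfl⟩ := e.surjective a
      rw [e.symm_apply_apply]
      rcases v with _ | ⟨s, a⟩ | j
      · exact h2 none
      · simpa [hR, hubCoins] using h1 s ((x s).succAbove a)
      · exact h2 (some j)
  rw [hpre, refMeasure, Measure.prod_prod, Measure.pi_pi, Measure.pi_pi, ← e.prod_comp]
  simp only [coinMeasure, Measure.pi_pi, Fintype.prod_option, Fintype.prod_sum_type,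
    Fintype.prod_prod_type, hO, Option.map_none, Option.map_some]
  have : ∀ s, ∏ u, tapeMeasure (R s u) = ∏ a, tapeMeasure (S (e (some (Sum.inl (s, a))))) := by
    intro s
    rw [Fin.prod_univ_succAbove _ (x s)]
    simp [hR]
  simp only [this]
  ring

/-! ### Messages of the cliques versus messages of the hub networks -/

/-- The IDs of two cliques on `m + 1` nodes, a hub and `k` pendants, and an enumeration of the nodes
of the hub networks that are made of them. -/
structure HubSetup (m k n N : ℕ) where
  e : HubNode m k ≃ Fin n
  idc : Bool → Fin (m + 1) → ℕ
  ido : Option (Fin k) → ℕ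
  id_injective : Function.Injective
    (Sum.elim (fun p : Bool × Fin (m + 1) => idc p.1 p.2) ido)
  idc_mem : ∀ s v, idc s v ∈ Set.Icc 1 N
  ido_mem : ∀ o, ido o ∈ Set.Icc 1 N

namespace HubSetup

variable {m k n N : ℕ} (D : HubSetup m k n N)

lemma idc_injective (s : Bool) : Function.Injective (D.idc s) := fun u v h => by
  simpa using D.id_injective (a₁ := Sum.inl (s, u)) (a₂ := Sum.inl (s, v)) h

lemma hubId_injective (x : Bool → Fin (m + 1)) : Function.Injective (hubId x D.idc D.ido) := by
  have h : hubId x D.idc D.ido = Sum.elim (fun p : Bool × Fin (m + 1) => D.idc p.1 p.2) D.ido ∘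
      fun v => match v with
        | none => Sum.inr none
        | some (Sum.inl (s, a)) => Sum.inl (s, (x s).succAbove a)
        | some (Sum.inr j) => Sum.inr (some j) := by
    funext v
    rcases v with _ | ⟨s, a⟩ | j <;> rfl
  rw [h]
  refine D.id_injective.comp ?_
  rintro (_ | ⟨s, a⟩ | j) (_ | ⟨s', a'⟩ | j') h <;> simp at h ⊢
  · obtain ⟨rfl, h⟩ := h
    simpa using h
  · exact h

lemma hubId_mem (x : Bool → Fin (m + 1)) : ∀ v, hubId x D.idc D.ido v ∈ Set.Icc 1 N := by
  rintro (_ | ⟨s, a⟩ | j)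
  · exact D.ido_mem _
  · exact D.idc_mem _ _
  · exact D.ido_mem _

/-- The clique of the nodes of group `s`. -/
noncomputable def K (s : Bool) : Network (m + 1) N :=
  clique (D.idc s) (D.idc_injective s) (D.idc_mem s)

/-- The hub network in which the hub takes the place of `x s` in both cliques. -/
noncomputable def G (x : Bool → Fin (m + 1)) : Network n N :=
  hubNet D.e x (hubId x D.idc D.ido) (D.hubId_injective x) (D.hubId_mem x)

/-- The coin flips of the nodes of a hub network. -/
def coins (x : Bool → Fin (m + 1)) (ω : RefCoins m k) : Fin n → ℕ → Bool := hubCoins x ω ∘ D.e.symm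

variable (A : Algorithm)

/-- Neither the hub nor a pendant spontaneously sends a message in the first `T` rounds. -/
def OuterQuiet (ω : RefCoins m k) (T : ℕ) : Prop :=
  ∀ o, A.Quiet n (D.ido o) (outerDeg m k o) T (ω.2 o)

/-- The traffic at the nodes of the cliques that the hub replaces. -/
noncomputable def hubTraffic (ω : RefCoins m k) (T : ℕ) (x : Bool → Fin (m + 1)) : ℕ :=
  ∑ s, (A.withSize n).traffic (D.K s) (ω.1 s) T (x s)

/-- The number of messages in the two separate cliques. -/
noncomputable def cliqueMessages (ω : RefCoins m k) (T : ℕ) : ℕ :=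
  ∑ s, (A.withSize n).messagesBefore (D.K s) (ω.1 s) T

lemma run_eq {ω : RefCoins m k} {T : ℕ} {x : Bool → Fin (m + 1)}
    (hx : D.hubTraffic A ω T x = 0) (hq : D.OuterQuiet A ω T) {t : ℕ} (ht : t ≤ T)
    (v : HubNode m k) :
    A.run (D.G x) (D.coins x ω) t (D.e v) = refRun A n D.K D.ido x ω t v :=
  run_hubNet A D.e x D.idc D.ido D.idc_injective D.idc_mem (D.hubId_injective x) (D.hubId_mem x) ω
    (fun s => Finset.sum_eq_zero_iff.mp hx s (Finset.mem_univ s)) hq ht v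

/-- For fixed `s`, each node equals `x s` for `M` of the `M ^ 2` choices of `x`. -/
lemma sum_apply {M : ℕ} (f : Bool → Fin M → ℕ) :
    ∑ x : Bool → Fin M, ∑ s, f s (x s) = M * ∑ s, ∑ u, f s u := by
  rw [← (Equiv.boolArrowEquivProd (Fin M)).symm.sum_comp, Fintype.sum_prod_type]
  simp [Equiv.boolArrowEquivProd, Finset.sum_add_distrib, mul_add, Finset.mul_sum]

lemma sum_hubTraffic (ω : RefCoins m k) (T : ℕ) :
    ∑ x, D.hubTraffic A ω T x = (m + 1) * (2 * D.cliqueMessages A ω T) := by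
  unfold hubTraffic cliqueMessages
  rw [sum_apply fun s => (A.withSize n).traffic (D.K s) (ω.1 s) T]
  simp only [(A.withSize n).sum_traffic, Finset.mul_sum]

/-- The number of messages that node `u` of clique `s` sends. -/
noncomputable def cliqueSends (ω : RefCoins m k) (T : ℕ) (s : Bool) (u : Fin (m + 1)) : ℕ :=
  ∑ t ∈ Finset.range T, A.sends m ((A.withSize n).run (D.K s) (ω.1 s) t u)

lemma sum_cliqueSends (ω : RefCoins m k) (T : ℕ) :
    ∑ s, ∑ u, D.cliqueSends A ω T s u = D.cliqueMessages A ω T := by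
  refine Finset.sum_congr rfl fun s _ => ?_
  unfold cliqueSends
  rw [Finset.sum_comm]
  rfl

/-- The messages of the hub network are at least those of the cliques, except for the messages of
the replaced nodes, as long as these have not communicated before. -/
lemma cliqueMessages_le {ω : RefCoins m k} {T : ℕ} {x : Bool → Fin (m + 1)}
    (hx : D.hubTraffic A ω T x = 0) (hq : D.OuterQuiet A ω T) :
    D.cliqueMessages A ω (T + 1) ≤ A.messagesBefore (D.G x) (D.coins x ω) (T + 1) +
      ∑ s, D.cliqueSends A ω (T + 1) s (x s) := by
  rw [← D.sum_cliqueSends]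
  simp_rw [fun s => Fin.sum_univ_succAbove (D.cliqueSends A ω (T + 1) s) (x s)]
  rw [Finset.sum_add_distrib, add_comm]
  refine Nat.add_le_add_right ?_ _
  unfold cliqueSends Algorithm.messagesBefore
  rw [← Fintype.sum_prod_type'
    (f := fun s a => ∑ t ∈ Finset.range (T + 1), A.sends m
      ((A.withSize n).run (D.K s) (ω.1 s) t ((x s).succAbove a))), Finset.sum_comm]
  refine Finset.sum_le_sum fun t ht => ?_
  -- Silence in the first `T` rounds fixes the states up to time `T`, and these already determine
  -- the messages of round `T + 1`.
  have ht' : t ≤ T := by simpa [Nat.lt_succ_iff] using ht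
  have h : A.messagesInRound (D.G x) (D.coins x ω) t =
      ∑ v : HubNode m k, A.sends v.deg (refRun A n D.K D.ido x ω t v) := by
    change ∑ v : Fin n, A.sends (HubNode.deg (D.e.symm v)) (A.run (D.G x) (D.coins x ω) t v) = _
    rw [← D.e.sum_comp]
    refine Finset.sum_congr rfl fun v _ => ?_
    rw [D.e.symm_apply_apply, D.run_eq A hx hq ht']
  rw [h, Fintype.sum_option, Fintype.sum_sum_type]
  refine le_trans ?_ (Nat.le_add_left _ _)
  exact Nat.le_add_right _ _

/-- If the cliques exchange many messages, then so do the hub networks on average. -/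
lemma le_sum_messagesBefore {ω : RefCoins m k} {T : ℕ} (hq : D.OuterQuiet A ω T) {κ : ℝ}
    (hκ : 0 < κ) (hm : 2 * (2 * κ + 1) ≤ (m + 1 : ℝ)) (h : κ ≤ D.cliqueMessages A ω T) :
    (m + 1 : ℝ) ^ 2 * (κ / 2) ≤ ∑ x, (A.messagesBefore (D.G x) (D.coins x ω) T : ℝ) := by
  classical
  -- `τ + 1` is the first time at which the cliques have sent `κ` messages; it is positive because
  -- the count at time 0 is 0.
  have hex : ∃ t, κ ≤ D.cliqueMessages A ω t := ⟨T, h⟩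
  obtain ⟨τ, hτ⟩ : ∃ τ, Nat.find hex = τ + 1 := by
    refine Nat.exists_eq_succ_of_ne_zero fun h0 => ?_
    have := Nat.find_spec hex
    rw [h0] at this
    simp [cliqueMessages, Algorithm.messagesBefore] at this
    linarith
  have h1 : κ ≤ D.cliqueMessages A ω (τ + 1) := hτ ▸ Nat.find_spec hex
  have h2 : (D.cliqueMessages A ω τ : ℝ) < κ := not_le.mp (Nat.find_min hex (by omega))
  have hτT : τ + 1 ≤ T := hτ ▸ Nat.find_min' hex h
  -- For places with traffic before `τ`, the last summand alone suffices. Its sum over `x` is small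
  -- because the cliques sent fewer than `κ` messages by then.
  have hpt : ∀ x, D.cliqueMessages A ω (τ + 1) ≤ A.messagesBefore (D.G x) (D.coins x ω) T +
      ∑ s, D.cliqueSends A ω (τ + 1) s (x s) +
      D.cliqueMessages A ω (τ + 1) * D.hubTraffic A ω τ x := by
    intro x
    by_cases hx : D.hubTraffic A ω τ x = 0
    · rw [hx, mul_zero, add_zero]
      refine (D.cliqueMessages_le A hx fun o t ht => hq o t (by omega)).trans
        (Nat.add_le_add_right ?_ _)
      exact Finset.sum_le_sum_of_subset (Finset.range_mono hτT)
    · exact (Nat.le_mul_of_pos_right _ (Nat.pos_of_ne_zero hx)).trans (Nat.le_add_left _ _)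
  have hsum := Finset.sum_le_sum fun x (_ : x ∈ Finset.univ) => hpt x
  rw [Finset.sum_add_distrib, Finset.sum_add_distrib, sum_apply (D.cliqueSends A ω (τ + 1)),
    ← Finset.mul_sum, sum_hubTraffic, sum_cliqueSends, Finset.sum_const, Finset.card_univ,
    Fintype.card_fun, Fintype.card_bool, Fintype.card_fin, smul_eq_mul] at hsum
  have hsum' : ((m + 1 : ℝ)) ^ 2 * D.cliqueMessages A ω (τ + 1) ≤
      ∑ x, (A.messagesBefore (D.G x) (D.coins x ω) T : ℝ) +
      (m + 1) * D.cliqueMessages A ω (τ + 1) +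
      D.cliqueMessages A ω (τ + 1) * ((m + 1) * (2 * D.cliqueMessages A ω τ)) := by
    exact_mod_cast hsum
  set H := (D.cliqueMessages A ω (τ + 1) : ℝ)
  set h' := (D.cliqueMessages A ω τ : ℝ)
  have hH : 0 < H := hκ.trans_le h1
  have hM : (0 : ℝ) < m + 1 := by positivity
  -- By `hm` and `h2`, `1 + 2 * h'` is at most half of `m + 1`, so at most half of the messages are
  -- lost on average.
  have h3 : (m + 1 : ℝ) * H * ((m + 1) / 2) ≤ (m + 1 : ℝ) * H * (m + 1 - 1 - 2 * h') :=
    mul_le_mul_of_nonneg_left (by linarith) (by positivity)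
  have h4 : (m + 1 : ℝ) ^ 2 * (κ / 2) ≤ (m + 1 : ℝ) ^ 2 * (H / 2) :=
    mul_le_mul_of_nonneg_left (by linarith) (by positivity)
  nlinarith

/-! ### Signs -/

/-- The sign `-1` stands for exactly one leader in clique `s` without `u`. -/
noncomputable def sign (T : ℕ) (s : Bool) (u : Fin (m + 1)) (η : Fin (m + 1) → ℕ → Bool) : ℝ :=
  1 - 2 * ind ((A.withSize n).OneLeaderOn (D.K s) {u}ᶜ η T)

/-- The sign `-1` stands for an isolated hub or pendant that elects itself. -/
noncomputable def outerSign (T : ℕ) (o : Option (Fin k)) (c : ℕ → Bool) : ℝ :=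
  1 - 2 * ind (A.status (A.silentRun n (D.ido o) (outerDeg m k o) c T) = Status.elected)

/-- The product of the signs of all components. -/
noncomputable def totalSign (T : ℕ) (x : Bool → Fin (m + 1)) (ω : RefCoins m k) : ℝ :=
  (∏ s, D.sign A T s (x s) (ω.1 s)) * ∏ o, D.outerSign A T o (ω.2 o)

lemma abs_one_sub_two_ind (p : Prop) : |1 - 2 * ind p| = 1 := by
  unfold ind; split_ifs <;> norm_num

lemma abs_totalSign (T : ℕ) (x : Bool → Fin (m + 1)) (ω : RefCoins m k) :
    |D.totalSign A T x ω| = 1 := by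
  simp [totalSign, abs_mul, Finset.abs_prod, sign, outerSign, abs_one_sub_two_ind]

/-- The component of the leader has sign `-1`. All nodes elsewhere are non-elected, so the other
signs are 1. The node `x s` is excluded from clique `s` because it is absent from the hub network.
-/
lemma totalSign_eq {ω : RefCoins m k} {T : ℕ} {x : Bool → Fin (m + 1)}
    (hx : D.hubTraffic A ω T x = 0) (hq : D.OuterQuiet A ω T)
    (h : A.OneLeader (D.G x) (D.coins x ω) T) : D.totalSign A T x ω = -1 := by
  obtain ⟨w, hw, hw'⟩ := h
  obtain ⟨w, rfl⟩ := D.e.surjective w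
  rw [D.run_eq A hx hq le_rfl] at hw
  replace hw' : ∀ v, v ≠ w → A.status (refRun A n D.K D.ido x ω T v) = Status.nonElected := by
    intro v hv
    rw [← D.run_eq A hx hq le_rfl]
    exact hw' _ (D.e.injective.ne hv)
  have hs1 : ∀ s, (∀ a, some (Sum.inl (s, a)) ≠ w) → D.sign A T s (x s) (ω.1 s) = 1 := by
    intro s hs
    rw [sign, ind_of_false, mul_zero, sub_zero]
    rintro ⟨u, hu, hu', -⟩
    obtain ⟨a, rfl⟩ := Fin.exists_succAbove_eq hu
    have := (hw' _ (hs a)).symm.trans hu'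
    cases this
  have ho1 : ∀ o : Option (Fin k), (o.map Sum.inr : HubNode m k) ≠ w →
      D.outerSign A T o (ω.2 o) = 1 := by
    intro o ho
    rw [outerSign, ind_of_false, mul_zero, sub_zero]
    intro h
    have h' := hw' _ ho
    rcases o with _ | j
    · cases h'.symm.trans h
    · cases h'.symm.trans h
  have houter : ∀ o : Option (Fin k), w = o.map Sum.inr → D.totalSign A T x ω = -1 := by
    rintro o rfl
    have h1 : ∏ s, D.sign A T s (x s) (ω.1 s) = 1 :=
      Finset.prod_eq_one fun s _ => hs1 s fun a => by cases o <;> simp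
    have h2 : D.outerSign A T o (ω.2 o) = -1 := by
      rw [outerSign, ind_of_true]
      · norm_num
      · rcases o with _ | j <;> exact hw
    rw [totalSign, h1, Fintype.prod_eq_single o, h2, one_mul]
    exact fun o' ho' => ho1 o' ((Option.map_injective Sum.inr_injective).ne ho')
  rcases w with _ | ⟨s, a⟩ | j
  · exact houter none rfl
  · have h1 : ∏ o, D.outerSign A T o (ω.2 o) = 1 :=
      Finset.prod_eq_one fun o _ => ho1 o (by cases o <;> simp)
    have h2 : D.sign A T s (x s) (ω.1 s) = -1 := by
      rw [sign, ind_of_true]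
      · norm_num
      · refine ⟨(x s).succAbove a, Fin.succAbove_ne _ _, hw, fun u hu hne => ?_⟩
        obtain ⟨b, rfl⟩ := Fin.exists_succAbove_eq hu
        exact hw' (some (Sum.inl (s, b))) (by rintro h; simp at h; exact hne (by rw [h]))
    rw [totalSign, h1, Fintype.prod_eq_single s, h2, mul_one]
    exact fun s' hs' => hs1 s' fun a' => by simp [hs']
  · exact houter (some j) rfl

/-- On average over the places of the hub, there is exactly one leader only if the signs multiply to
`-1`, or a hub or pendant is not quiet, or many messages are sent. -/
lemma sum_ind_oneLeader_le (ω : RefCoins m k) (T : ℕ) {κ : ℝ} (hκ : 0 < κ)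
    (hm : 2 * (2 * κ + 1) ≤ (m + 1 : ℝ)) :
    ∑ x, ind (A.OneLeader (D.G x) (D.coins x ω) T) ≤
      ∑ x, (1 - D.totalSign A T x ω) / 2 +
      (m + 1 : ℝ) ^ 2 * ∑ o, ind (¬ A.Quiet n (D.ido o) (outerDeg m k o) T (ω.2 o)) +
      2 * (m + 1) * κ + 2 / κ * ∑ x, (A.messagesBefore (D.G x) (D.coins x ω) T : ℝ) := by
  have hg : ∀ x, 0 ≤ (1 - D.totalSign A T x ω) / 2 := fun x => by
    linarith [(abs_le.mp (D.abs_totalSign A T x ω).le).2]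
  have hg' := Finset.sum_nonneg fun x (_ : x ∈ Finset.univ) => hg x
  have hQ : (0 : ℝ) ≤ ∑ o, ind (¬ A.Quiet n (D.ido o) (outerDeg m k o) T (ω.2 o)) :=
    Finset.sum_nonneg fun _ _ => ind_nonneg
  have hM : (0 : ℝ) ≤ ∑ x, (A.messagesBefore (D.G x) (D.coins x ω) T : ℝ) :=
    Finset.sum_nonneg fun _ _ => Nat.cast_nonneg _
  have hM' : 0 ≤ 2 / κ * ∑ x, (A.messagesBefore (D.G x) (D.coins x ω) T : ℝ) := by positivity
  have hQ' := mul_nonneg (sq_nonneg (m + 1 : ℝ)) hQ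
  have hκ' : 0 ≤ 2 * (m + 1) * κ := by positivity
  have hall : ∑ x, ind (A.OneLeader (D.G x) (D.coins x ω) T) ≤ (m + 1 : ℝ) ^ 2 := by
    refine (Finset.sum_le_sum fun x _ => ind_le_one).trans ?_
    simp
  -- A hub or pendant that is not quiet, or at least `κ` clique messages, makes one error term reach
  -- the trivial bound `(m + 1) ^ 2`. Otherwise only places with traffic are exceptional, and
  -- `sum_hubTraffic` bounds their number.
  by_cases hq : D.OuterQuiet A ω T
  · by_cases h : κ ≤ D.cliqueMessages A ω T
    · have h1 := mul_le_mul_of_nonneg_left (D.le_sum_messagesBefore A hq hκ hm h)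
        (show 0 ≤ 2 / κ by positivity)
      have h2 : 2 / κ * ((m + 1 : ℝ) ^ 2 * (κ / 2)) = (m + 1 : ℝ) ^ 2 := by
        field_simp
      linarith
    · have h1 : ∀ x, ind (A.OneLeader (D.G x) (D.coins x ω) T) ≤
          (1 - D.totalSign A T x ω) / 2 + D.hubTraffic A ω T x := by
        intro x
        by_cases hx : D.hubTraffic A ω T x = 0
        · by_cases hl : A.OneLeader (D.G x) (D.coins x ω) T
          · rw [ind_of_true hl, D.totalSign_eq A hx hq hl, hx]
            norm_num
          · rw [ind_of_false hl, hx]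
            simpa using hg x
        · have : (1 : ℝ) ≤ D.hubTraffic A ω T x := by
            exact_mod_cast Nat.one_le_iff_ne_zero.mpr hx
          linarith [hg x, ind_le_one (p := A.OneLeader (D.G x) (D.coins x ω) T)]
      have h2 := Finset.sum_le_sum fun x (_ : x ∈ Finset.univ) => h1 x
      rw [Finset.sum_add_distrib] at h2
      have h3 : ∑ x, (D.hubTraffic A ω T x : ℝ) = (m + 1) * (2 * D.cliqueMessages A ω T) := by
        exact_mod_cast D.sum_hubTraffic A ω T
      have h4 : (m + 1 : ℝ) * (2 * D.cliqueMessages A ω T) ≤ (m + 1) * (2 * κ) :=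
        mul_le_mul_of_nonneg_left (by linarith) (by positivity)
      linarith
  · have h1 : 1 ≤ ∑ o, ind (¬ A.Quiet n (D.ido o) (outerDeg m k o) T (ω.2 o)) := by
      obtain ⟨o, ho⟩ := not_forall.mp hq
      rw [← ind_of_true ho]
      exact Finset.single_le_sum (f := fun o => ind (¬ A.Quiet n (D.ido o) (outerDeg m k o) T (ω.2 o)))
        (fun _ _ => ind_nonneg) (Finset.mem_univ o)
    have h2 := mul_le_mul_of_nonneg_left h1 (sq_nonneg (m + 1 : ℝ))
    linarith

/-! ### Integration of the signs -/

lemma measurable_one_sub_two_ind {Ω : Type*} [MeasurableSpace Ω] {q : Ω → Prop}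
    (hq : MeasurableSet {ω | q ω}) : Measurable fun ω => 1 - 2 * ind (q ω) := by
  classical
  exact measurable_const.sub (measurable_const.mul (Measurable.ite hq measurable_const
    measurable_const))

lemma measurable_sign (T : ℕ) (s : Bool) (u : Fin (m + 1)) : Measurable (D.sign A T s u) :=
  measurable_one_sub_two_ind ((A.withSize n).measurableSet_oneLeaderOn _ _ _)

lemma measurable_outerSign (T : ℕ) (o : Option (Fin k)) : Measurable (D.outerSign A T o) :=
  measurable_one_sub_two_ind (A.measurableSet_silent_status _ _ _ _ _)

lemma integrable_totalSign (T : ℕ) (x : Bool → Fin (m + 1)) :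
    Integrable (D.totalSign A T x) (refMeasure m k) := by
  have hm : Measurable (D.totalSign A T x) := by
    refine Measurable.mul (Finset.measurable_prod _ fun s _ => ?_)
      (Finset.measurable_prod _ fun o _ => ?_)
    · exact (D.measurable_sign A T s _).comp ((measurable_pi_apply s).comp measurable_fst)
    · exact (D.measurable_outerSign A T o).comp ((measurable_pi_apply o).comp measurable_snd)
  refine Integrable.of_bound hm.aestronglyMeasurable 1 (Filter.Eventually.of_forall fun ω => ?_)
  rw [Real.norm_eq_abs, D.abs_totalSign]

/-- The components are independent. -/
lemma sum_integral_totalSign (T : ℕ) :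
    ∑ x, ∫ ω, D.totalSign A T x ω ∂refMeasure m k =
      (∏ s, ∑ u, ∫ η, D.sign A T s u η ∂coinMeasure (m + 1)) *
        ∏ o, ∫ c, D.outerSign A T o c ∂tapeMeasure := by
  have h : ∀ x, ∫ ω, D.totalSign A T x ω ∂refMeasure m k =
      (∏ s, ∫ η, D.sign A T s (x s) η ∂coinMeasure (m + 1)) *
        ∏ o, ∫ c, D.outerSign A T o c ∂tapeMeasure := by
    intro x
    unfold totalSign refMeasure
    rw [integral_prod_mul (fun η : Bool → Fin (m + 1) → ℕ → Bool =>
      ∏ s, D.sign A T s (x s) (η s)) fun c : Option (Fin k) → ℕ → Bool =>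
      ∏ o, D.outerSign A T o (c o),
      integral_fintype_prod_eq_prod (fun s => D.sign A T s (x s)),
      integral_fintype_prod_eq_prod (fun o => D.outerSign A T o)]
  simp only [h]
  -- The places `x s` vary independently of each other, so the sum of products over `x` is a product
  -- of sums.
  rw [← Finset.sum_mul, Finset.prod_univ_sum, Fintype.piFinset_univ]

/-- The advantage over `1 / 2` is bounded if the signs are not negative on average. -/
lemma advantage_le {T : ℕ} {κ b δ η : ℝ} (hκ : 0 < κ) (hb : 0 ≤ b)
    (hm : 2 * (2 * κ + 1) ≤ (m + 1 : ℝ))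
    (hlead : ∀ x, 1 / 2 + δ ≤ (coinMeasure n).real {ω | A.OneLeader (D.G x) ω T})
    (hmsg : ∀ x, A.expectedMessages (D.G x) ≤ ENNReal.ofReal b)
    (hsign : 0 ≤ ∏ s, ∑ u, ∫ η, D.sign A T s u η ∂coinMeasure (m + 1))
    (houter : ∀ o, 0 ≤ ∫ c, D.outerSign A T o c ∂tapeMeasure)
    (hquiet : ∀ o, tapeMeasure.real {c | ¬ A.Quiet n (D.ido o) (outerDeg m k o) T c} ≤ η) :
    δ ≤ (k + 1) * η + 2 * κ / (m + 1) + 2 / κ * b := by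
  have hmp : ∀ x, MeasurePreserving (D.coins x) (refMeasure m k) (coinMeasure n) :=
    fun x => measurePreserving_hubCoins D.e x
  have hLm : ∀ x, MeasurableSet {ω | A.OneLeader (D.G x) (D.coins x ω) T} := fun x =>
    (A.measurableSet_oneLeader (D.G x) T).preimage (hmp x).measurable
  have hL : ∀ x, 1 / 2 + δ ≤ ∫ ω, ind (A.OneLeader (D.G x) (D.coins x ω) T) ∂refMeasure m k := by
    intro x
    rw [integral_ind (hLm x)]
    exact (hlead x).trans_eq ((hmp x).measureReal_preimage
      (A.measurableSet_oneLeader (D.G x) T).nullMeasurableSet).symm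
  have hmi := fun x => A.integrable_messagesBefore ((hmsg x).trans_lt ENNReal.ofReal_lt_top).ne T
  have hMi : ∀ x, Integrable (fun ω => (A.messagesBefore (D.G x) (D.coins x ω) T : ℝ)) (refMeasure m k) :=
    fun x => (hmp x).integrable_comp_of_integrable (hmi x)
  have hM : ∀ x, ∫ ω, (A.messagesBefore (D.G x) (D.coins x ω) T : ℝ) ∂refMeasure m k ≤ b := by
    intro x
    have := integral_map (hmp x).aemeasurable (f := fun ω => (A.messagesBefore (D.G x) ω T : ℝ))
      ((hmp x).map_eq ▸ (hmi x).aestronglyMeasurable)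
    rw [← this, (hmp x).map_eq]
    exact A.integral_messagesBefore_le hb (hmsg x) T
  have hev : ∀ o, MeasurePreserving (fun ω : RefCoins m k => ω.2 o) (refMeasure m k) tapeMeasure := fun o =>
    (measurePreserving_eval _ o).comp measurePreserving_snd
  have hQm : ∀ o, MeasurableSet {c | ¬ A.Quiet n (D.ido o) (outerDeg m k o) T c} := fun o =>
    (A.measurableSet_quiet _ _ _ _).compl
  have hQm' : ∀ o, MeasurableSet
      {ω : RefCoins m k | ¬ A.Quiet n (D.ido o) (outerDeg m k o) T (ω.2 o)} := fun o =>
    (hQm o).preimage (hev o).measurable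
  have hQ : ∀ o, ∫ ω : RefCoins m k, ind (¬ A.Quiet n (D.ido o) (outerDeg m k o) T (ω.2 o)) ∂refMeasure m k ≤
      η := by
    intro o
    rw [integral_ind (hQm' o)]
    exact ((hev o).measureReal_preimage (hQm o).nullMeasurableSet).trans_le (hquiet o)
  have hsi : ∀ x, Integrable (fun ω => (1 - D.totalSign A T x ω) / 2) (refMeasure m k) := fun x =>
    ((integrable_const _).sub (D.integrable_totalSign A T x)).div_const 2
  have hi1 := integrable_finsetSum Finset.univ fun x (_ : x ∈ Finset.univ) => hsi x
  have hi2 : Integrable (fun ω : RefCoins m k => (m + 1 : ℝ) ^ 2 *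
      ∑ o, ind (¬ A.Quiet n (D.ido o) (outerDeg m k o) T (ω.2 o))) (refMeasure m k) :=
    (integrable_finsetSum _ fun o _ => integrable_ind (hQm' o)).const_mul _
  have hi3 : Integrable (fun ω => 2 / κ *
      ∑ x, (A.messagesBefore (D.G x) (D.coins x ω) T : ℝ)) (refMeasure m k) :=
    (integrable_finsetSum _ fun x _ => hMi x).const_mul _
  have hbound := integral_mono
    (integrable_finsetSum _ fun x _ => integrable_ind (hLm x))
    (((hi1.add hi2).add (integrable_const (2 * (m + 1) * κ))).add hi3)
    fun ω => D.sum_ind_oneLeader_le A ω T hκ hm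
  rw [integral_finsetSum _ fun x _ => integrable_ind (hLm x),
    integral_add' ((hi1.add hi2).add (integrable_const _)) hi3,
    integral_add' (hi1.add hi2) (integrable_const _), integral_add' hi1 hi2, integral_const_mul,
    integral_const_mul, integral_const_mul, integral_finsetSum _ fun x _ => hMi x,
    integral_finsetSum _ fun o _ => integrable_ind (hQm' o),
    integral_finsetSum _ fun x _ => hsi x] at hbound
  have hcard : (Fintype.card (Bool → Fin (m + 1)) : ℝ) = (m + 1 : ℝ) ^ 2 := by simp
  have h1 : (m + 1 : ℝ) ^ 2 * (1 / 2 + δ) ≤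
      ∑ x, ∫ ω, ind (A.OneLeader (D.G x) (D.coins x ω) T) ∂refMeasure m k := by
    refine le_trans (le_of_eq ?_) (Finset.sum_le_sum fun x _ => hL x)
    rw [Finset.sum_const, nsmul_eq_mul, Finset.card_univ, hcard]
  -- This is where `1/2` comes from: the mean total sign, summed over `x`, is nonnegative.
  have h2 : ∑ x, ∫ ω, (1 - D.totalSign A T x ω) / 2 ∂refMeasure m k ≤ (m + 1 : ℝ) ^ 2 / 2 := by
    have h : ∀ x, ∫ ω, (1 - D.totalSign A T x ω) / 2 ∂refMeasure m k =
        1 / 2 - (∫ ω, D.totalSign A T x ω ∂refMeasure m k) / 2 := by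
      intro x
      rw [integral_div, integral_sub (integrable_const _) (D.integrable_totalSign A T x)]
      simp [sub_div]
    simp only [h]
    rw [Finset.sum_sub_distrib, ← Finset.sum_div Finset.univ fun x => ∫ ω, D.totalSign A T x ω ∂_,
      D.sum_integral_totalSign, Finset.sum_const,
      nsmul_eq_mul, Finset.card_univ, hcard]
    have := mul_nonneg hsign (Finset.prod_nonneg fun o (_ : o ∈ Finset.univ) => houter o)
    linarith
  have h3 : ∑ o, ∫ ω : RefCoins m k,
      ind (¬ A.Quiet n (D.ido o) (outerDeg m k o) T (ω.2 o)) ∂refMeasure m k ≤ (k + 1) * η := by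
    refine (Finset.sum_le_sum fun o _ => hQ o).trans (le_of_eq ?_)
    simp
  have h4 : ∑ x, ∫ ω, (A.messagesBefore (D.G x) (D.coins x ω) T : ℝ) ∂refMeasure m k ≤ (m + 1 : ℝ) ^ 2 * b := by
    refine (Finset.sum_le_sum fun x _ => hM x).trans (le_of_eq ?_)
    rw [Finset.sum_const, nsmul_eq_mul, Finset.card_univ, hcard]
  have h5 : ∫ _, κ ∂refMeasure m k = κ := by simp
  rw [h5] at hbound
  have hM2 : (0 : ℝ) < (m + 1 : ℝ) ^ 2 := by positivity
  have h3' := mul_le_mul_of_nonneg_left h3 hM2.le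
  have h4' := mul_le_mul_of_nonneg_left h4 (show 0 ≤ 2 / κ by positivity)
  have h6 : (m + 1 : ℝ) ^ 2 * (2 * κ / (m + 1)) = 2 * (m + 1) * κ := by
    field_simp
  refine le_of_mul_le_mul_left ?_ hM2
  nlinarith

end HubSetup

/-! ### Choice of the IDs and conclusion -/

/-- Pigeonhole on weak signs. Three candidates are needed, since two could have opposite signs;
hence three blocks of IDs for the cliques. -/
lemma exists_mul_nonneg (a : Fin 3 → ℝ) : ∃ p q, p ≠ q ∧ 0 ≤ a p * a q := by
  rcases le_total 0 (a 0) with h0 | h0 <;> rcases le_total 0 (a 1) with h1 | h1 <;>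
    rcases le_total 0 (a 2) with h2 | h2
  · exact ⟨0, 1, by decide, mul_nonneg h0 h1⟩
  · exact ⟨0, 1, by decide, mul_nonneg h0 h1⟩
  · exact ⟨0, 2, by decide, mul_nonneg h0 h2⟩
  · exact ⟨1, 2, by decide, mul_nonneg_of_nonpos_of_nonpos h1 h2⟩
  · exact ⟨1, 2, by decide, mul_nonneg h1 h2⟩
  · exact ⟨0, 2, by decide, mul_nonneg_of_nonpos_of_nonpos h0 h2⟩
  · exact ⟨0, 1, by decide, mul_nonneg_of_nonpos_of_nonpos h0 h1⟩
  · exact ⟨0, 1, by decide, mul_nonneg_of_nonpos_of_nonpos h0 h1⟩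

/-- The `u`-th ID of the `b`-th block of `n` IDs. -/
def blockId (n b u : ℕ) : ℕ := b * n + u + 1

lemma blockId_inj {n b b' u u' : ℕ} (hu : u < n) (hu' : u' < n)
    (h : blockId n b u = blockId n b' u') : b = b' ∧ u = u' := by
  have h' : u + n * b = u' + n * b' := by unfold blockId at h; linarith
  have hn : 0 < n := by omega
  have h1 := congrArg (· / n) h'
  have h2 := congrArg (· % n) h'
  simp only [Nat.add_mul_div_left _ _ hn, Nat.div_eq_of_lt hu, Nat.div_eq_of_lt hu'] at h1
  simp only [Nat.add_mul_mod_self_left, Nat.mod_eq_of_lt hu, Nat.mod_eq_of_lt hu'] at h2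
  omega

lemma blockId_mem {n N b u : ℕ} (hN : 5 * n ≤ N) (hb : b < 5) (hu : u < n) :
    blockId n b u ∈ Set.Icc 1 N := by
  refine ⟨Nat.le_add_left _ _, ?_⟩
  have : b * n ≤ 4 * n := Nat.mul_le_mul_right n (by omega)
  unfold blockId
  omega

/-- The complete network with the IDs of block `b`. -/
noncomputable def blockClique {l n N : ℕ} (hN : 5 * n ≤ N) (hl : l < n) (b : Fin 5) :
    Network (l + 1) N :=
  clique (fun u => blockId n b u)
    (fun u u' h => Fin.ext (blockId_inj (by omega) (by omega) h).2)
    fun u => blockId_mem hN b.2 (by omega)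

/-- The star with the IDs of the last block. -/
noncomputable def starNet {l N : ℕ} (hN : 5 * (l + 1) ≤ N) (e : HubNode 0 l ≃ Fin (l + 1)) :
    Network (l + 1) N :=
  hubNet e (fun _ => 0) (fun v => blockId (l + 1) 4 (e v))
    (fun v v' h => e.injective (Fin.ext (blockId_inj (e v).2 (e v').2 h).2))
    fun v => blockId_mem hN (by omega) (e v).2

/-- Hub networks with IDs of different blocks for the groups, the hub and the pendants. -/
noncomputable def blockSetup {m k N : ℕ} (hN : 5 * (2 * m + k + 1) ≤ N) (hk : k ≤ 1)
    (e : HubNode m k ≃ Fin (2 * m + k + 1))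
    (c : {c : Bool → Fin 3 // Function.Injective c}) (i j : Fin (2 * m + k + 1)) :
    HubSetup m k (2 * m + k + 1) N where
  e := e
  idc s u := blockId (2 * m + k + 1) (c.1 s).1 u
  ido
    | none => blockId (2 * m + k + 1) 3 i
    | some _ => blockId (2 * m + k + 1) 4 j
  id_injective := by
    rintro (⟨s, u⟩ | (_ | o)) (⟨s', u'⟩ | (_ | o')) h <;>
      have h' := blockId_inj (by omega) (by omega) h
    · obtain rfl := c.2 (Fin.ext h'.1)
      obtain rfl := Fin.ext h'.2
      rfl
    · have := (c.1 s).2; omega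
    · have := (c.1 s).2; omega
    · have := (c.1 s').2; omega
    · rfl
    · omega
    · have := (c.1 s').2; omega
    · omega
    · obtain rfl : o = o' := Fin.ext (by omega)
      rfl
  idc_mem s u := blockId_mem hN (by omega) (by omega)
  ido_mem
    | none => blockId_mem hN (by omega) i.2
    | some _ => blockId_mem hN (by omega) j.2

/-- Blocks 0, 1, 2 serve the cliques, block 3 the hub and block 4 the pendant, which keeps all IDs
distinct and needs only `5 * n ≤ N`. -/
theorem exists_expectedMessages_ge {ε : ℝ} (hε : 0 < ε) {m k N : ℕ} (hk : k ≤ 1) (hm : 3 ≤ m)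
    (hn : 64 / ε ≤ (2 * m + k + 1 : ℕ)) (hN : 5 * (2 * m + k + 1) ≤ N) (A : Algorithm)
    (hA : ∀ net : Network (2 * m + k + 1) N, net.graph.ediam ≤ 2 → 1 / 2 + ε ≤ A.successProb net) :
    ∃ net : Network (2 * m + k + 1) N, net.graph.ediam ≤ 2 ∧
      ENNReal.ofReal (ε ^ 2 / 4096 * (2 * m + k + 1 : ℕ)) ≤ A.expectedMessages net := by
  by_contra! hfew
  set n := 2 * m + k + 1 with hndef
  set b : ℝ := ε ^ 2 / 4096 * n with hbdef
  have hb : 0 ≤ b := by positivity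
  let e : HubNode m k ≃ Fin n := Fintype.equivFinOfCardEq (by simp [hndef])
  let e' : HubNode 0 (2 * m + k) ≃ Fin n := Fintype.equivFinOfCardEq (by simp [hndef])
  set Kn : Network n N := blockClique hN (Nat.lt_succ_self (2 * m + k)) 3 with hKn
  set St : Network n N := starNet hN e' with hSt
  set D := fun c i j => blockSetup (m := m) hN hk e c i j with hD
  have hdK : Kn.graph.ediam ≤ 2 := ediam_clique _ _ _
  have hdS : St.graph.ediam ≤ 2 := ediam_hubNet _ _ _ _ _
  have hdG : ∀ c i j x, ((D c i j).G x).graph.ediam ≤ 2 := fun c i j x => ediam_hubNet _ _ _ _ _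
  have hε2 : ε ≤ 1 / 2 := by
    have h1 := hA Kn hdK
    have h2 : A.successProb Kn ≤ 1 := measureReal_le_one
    linarith
  have hlt : 1 / 2 + ε / 2 < 1 / 2 + ε := by linarith
  -- `T` must be fixed before `c`, `i` and `j` are chosen, since their choice depends on it.
  -- Finitely many networks are involved, so one `T` serves all.
  obtain ⟨T, ⟨hTK, hTS⟩, hTG⟩ := (((A.eventually_oneLeader hlt (hA Kn hdK)).and
    (A.eventually_oneLeader hlt (hA St hdS))).and
    (Filter.eventually_all.mpr fun c => Filter.eventually_all.mpr fun i =>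
      Filter.eventually_all.mpr fun j => Filter.eventually_all.mpr fun x =>
        A.eventually_oneLeader hlt (hA _ (hdG c i j x)))).exists
  have hnε : 64 ≤ ε * n := by
    have := (div_le_iff₀ hε).mp hn
    linarith
  have hnum : ∀ {S : ℕ}, (n : ℝ) - 1 ≤ S → 1 + 2 * b * (1 + 16 / ε) ≤ ε / 2 * S := by
    intro S hS
    have h1 : 2 * b * (1 + 16 / ε) = n * ε * (ε + 16) / 2048 := by
      rw [hbdef]; field_simp; ring
    rw [h1]
    nlinarith
  -- Nodes of the complete network have the degree of the hub, and leaves of the star that of a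
  -- pendant. A silent run depends only on size, ID, degree and coins, so the bounds carry over. The
  -- weight `16 / ε` bounds the probability of speaking by `ε / 32`.
  obtain ⟨i, -, hi⟩ := A.exists_quiet_node (S := Finset.univ) (d := 2 * m + k) (fun v _ => rfl)
    (Finset.univ_nonempty (α := Fin n)) hb (by positivity : 0 ≤ 16 / ε) (hfew Kn hdK).le hTK
    (hnum (by simp))
  obtain ⟨j, -, hj⟩ := A.exists_quiet_node (net := St) (d := 1)
    (S := (Finset.univ : Finset (Fin (2 * m + k))).map
      ⟨fun j => e' (some (Sum.inr j)), fun _ _ h => by simpa using h⟩)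
    (by
      intro v hv
      obtain ⟨j, -, rfl⟩ := Finset.mem_map.mp hv
      change HubNode.deg (e'.symm (e' (some (Sum.inr j)))) = 1
      rw [e'.symm_apply_apply]
      rfl)
    (Finset.card_pos.mp (by rw [Finset.card_map, Finset.card_univ, Fintype.card_fin]; omega))
    hb (by positivity : 0 ≤ 16 / ε) (hfew St hdS).le hTS
    (hnum (by rw [Finset.card_map, Finset.card_univ, Fintype.card_fin, hndef]; push_cast; linarith))
  obtain ⟨p, q, hpq, hsign⟩ := exists_mul_nonneg fun p => ∑ u, ∫ η, (1 - 2 *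
    ind ((A.withSize n).OneLeaderOn (blockClique hN (by omega : m < n) (p.castLE (by omega)))
      {u}ᶜ η T)) ∂coinMeasure (m + 1)
  have hc : Function.Injective fun s : Bool => cond s p q := by
    rintro (_ | _) (_ | _) h
    · rfl
    · exact absurd h.symm hpq
    · exact absurd h hpq
    · rfl
  set D' := D ⟨_, hc⟩ i j with hD'
  have hidi : Kn.id i = blockId n 3 i := rfl
  have hidj : St.id j = blockId n 4 j := by
    change blockId n 4 (e' (e'.symm j)) = _
    rw [e'.apply_symm_apply]
  rw [hidi] at hi
  rw [hidj] at hj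
  have houter : ∀ o, tapeMeasure.real {c | A.status (A.silentRun n (D'.ido o) (outerDeg m k o) c T)
      = Status.elected} + 16 / ε * tapeMeasure.real
        {c | ¬ A.Quiet n (D'.ido o) (outerDeg m k o) T c} ≤ 1 / 2 := by
    rintro (_ | o)
    · exact hi
    · exact hj
  have hmM : (0 : ℝ) < m + 1 := by positivity
  have hm3 : (3 : ℝ) ≤ m := by exact_mod_cast hm
  have hk1 : (k : ℝ) ≤ 1 := by exact_mod_cast hk
  -- With this `κ` the three error terms are at most `ε / 16`, `ε / 16` and `ε / 32`, less than `ε /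
  -- 2` in total.
  have hfinal := D'.advantage_le A (T := T) (κ := ε * (m + 1) / 32) (b := b) (δ := ε / 2)
    (η := ε / 32) (by positivity) hb (by nlinarith) (hTG _ i j) (fun x => (hfew _ (hdG _ _ _ x)).le)
    (by rw [Fintype.prod_bool]; exact hsign)
    (by
      intro o
      have hms := A.measurableSet_silent_status n (D'.ido o) (outerDeg m k o) T Status.elected
      unfold HubSetup.outerSign
      rw [integral_sub (integrable_const _) ((integrable_ind hms).const_mul 2), integral_const_mul,
        integral_ind hms]
      have h0 : 0 ≤ 16 / ε * tapeMeasure.real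
        {c | ¬ A.Quiet n (D'.ido o) (outerDeg m k o) T c} := by positivity
      have := houter o
      simp only [integral_const, probReal_univ, smul_eq_mul, mul_one]
      linarith)
    (by
      intro o
      have h0 : 0 ≤ tapeMeasure.real {c | A.status (A.silentRun n (D'.ido o) (outerDeg m k o) c T)
        = Status.elected} := measureReal_nonneg
      have h1 : 16 / ε * tapeMeasure.real
        {c | ¬ A.Quiet n (D'.ido o) (outerDeg m k o) T c} ≤ 1 / 2 := by linarith [houter o]
      rw [div_mul_eq_mul_div, div_le_iff₀ hε] at h1
      linarith)
  have h1 : 2 * (ε * (m + 1) / 32) / (m + 1 : ℝ) = ε / 16 := by field_simp; norm_num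
  have h2 : 2 / (ε * (m + 1) / 32) * b = ε / 64 * (n / (m + 1)) := by
    rw [hbdef]; field_simp; ring
  have h3 : (n : ℝ) / (m + 1) ≤ 2 := by
    rw [div_le_iff₀ hmM, hndef]
    push_cast
    linarith
  rw [h1, h2] at hfinal
  nlinarith

end LeaderElection

theorem theorem2 (ε : ℝ) (hε : 0 < ε) :
    ∃ c : ℝ, 0 < c ∧ ∃ n₀ : ℕ, ∀ n : ℕ, n₀ ≤ n → ∀ N : ℕ, n ^ 4 ≤ N →
      ∀ A : LeaderElection.Algorithm,
        (∀ net : LeaderElection.Network n N, net.graph.ediam ≤ 2 →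
          1 / 2 + ε ≤ A.successProb net) →
        ∃ net : LeaderElection.Network n N, net.graph.ediam ≤ 2 ∧
          ENNReal.ofReal (c * n) ≤ A.expectedMessages net := by
  -- `8 ≤ n` gives `3 ≤ m` and `5 * n ≤ n ^ 4`; `64 / ε ≤ n` absorbs the additive constants in the
  -- averaging.
  refine ⟨ε ^ 2 / 4096, by positivity, max 8 ⌈64 / ε⌉₊, fun n hn N hN A hA => ?_⟩
  have hn8 : 8 ≤ n := (le_max_left _ _).trans hn
  have hnε : 64 / ε ≤ n := (Nat.le_ceil _).trans (by exact_mod_cast (le_max_right _ _).trans hn)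
  have hN5 : 5 * n ≤ N := by
    refine le_trans ?_ hN
    have : 5 ≤ n ^ 3 := (by omega : 5 ≤ n).trans (Nat.le_self_pow (by norm_num) n)
    calc 5 * n ≤ n ^ 3 * n := Nat.mul_le_mul_right n this
      _ = n ^ 4 := by ring
  obtain ⟨m, k, hk, rfl⟩ : ∃ m k, k ≤ 1 ∧ n = 2 * m + k + 1 :=
    ⟨(n - 1) / 2, (n - 1) % 2, by omega, by omega⟩
  exact LeaderElection.exists_expectedMessages_ge hε hk (by omega) hnε hN5 A hA
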